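/- Let $S=\mathbb{C}[x_0,x_1,x_2,x_3]$ and let $V(f):f=0$ be a surface in $\mathbb{P}^3$ with (at most) isolated singularities, where $f\in S_d$ is homogeneous of degree $d\ge 3$. Let $J(f)\subset S$ be the Jacobian ideal generated by the first order partial derivatives of $f$, and let $M(f)=S/J(f)$ be the graded Jacobian algebra. Let $H:\ell=0$ be a plane in $\mathbb{P}^3$, with $\ell\in S_1$ nonzero, which contains no singular point of $V(f)$. Choose linear coordinates $y_1,y_2,y_3$ on $H$, put $R=\mathbb{C}[y_1,y_2,y_3]$, and let $g\in R_d$ be the restriction of $f$ to $H$, so that the plane section $V(f)\cap H$ is the plane curve $g=0$. Write $g_j=\partial g/\partial y_j$, let $$\mathrm{Syz}(g)=\{(a_1,a_2,a_3)\in R^3 : a_1g_1+a_2g_2+a_3g_3=0\}$$ be the graded module of first order syzygies, and let $N(g)=I(g)/J(g)$, where $J(g)=(g_1,g_2,g_3)$ and $I(g)$ is the saturation of $J(g)$ with respect to the ideal $(y_1,y_2,y_3)$. Let $d_1\le d_2$ be nonnegative integers, and suppose that the reduced curve $g=0$ satisfies one of the following two conditions. 1. It is free with exponents $(d_1,d_2)$: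 the $R$-module $\mathrm{Syz}(g)$ is free, with a basis of two homogeneous elements of degrees $d_1$ and $d_2$. 2. It is nearly free with exponents $(d_1,d_2)$: one has $N(g)\neq 0$ and $\dim_{\mathbb{C}} N(g)_j\le 1$ for all $j$, and $\mathrm{Syz}(g)$ has a minimal system of homogeneous generators consisting of three elements, of degrees $d_1,d_2,d_2$. Then for every integer $k\le d+d_1-3$ the multiplication map $$\ell: M(f)_k\to M(f)_{k+1}$$ is injective. -/

import Mathlib

namespace JacobianLefschetz

open MvPolynomial

/-- The Jacobian ideal `J(f)`, generated by all first order partial derivatives of `f`. -/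
noncomputable def jacobianIdeal {n : ℕ} (f : MvPolynomial (Fin n) ℂ) :
    Ideal (MvPolynomial (Fin n) ℂ) :=
  Ideal.span (Set.range fun i => pderiv i f)

/-- The Jacobian (Milnor) algebra `M(f) = S / J(f)`. -/
abbrev MilnorAlgebra {n : ℕ} (f : MvPolynomial (Fin n) ℂ) : Type :=
  MvPolynomial (Fin n) ℂ ⧸ jacobianIdeal f

/-- The degree `k` piece `M(f)_k` of the Jacobian algebra: the classes of the homogeneous
polynomials of degree `k`. -/
noncomputable def milnorPiece {n : ℕ} (f : MvPolynomial (Fin n) ℂ) (k : ℕ) :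
    Submodule ℂ (MilnorAlgebra f) :=
  (homogeneousSubmodule (Fin n) ℂ k).map (Ideal.Quotient.mkₐ ℂ (jacobianIdeal f)).toLinearMap

theorem mul_mem_milnorPiece {n : ℕ} (f l : MvPolynomial (Fin n) ℂ) (hl : l.IsHomogeneous 1)
    (k : ℕ) : ∀ m ∈ milnorPiece f k,
      LinearMap.mulLeft ℂ (Ideal.Quotient.mk (jacobianIdeal f) l) m ∈ milnorPiece f (k + 1) := by
  rintro _ ⟨q, hq, rfl⟩
  refine ⟨l * q, ?_, ?_⟩
  · have h := hl.mul ((mem_homogeneousSubmodule k q).1 hq)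
    rw [add_comm] at h
    exact (mem_homogeneousSubmodule (k + 1) (l * q)).2 h
  · simp

/-- Multiplication by the linear form `l`, as a linear map `M(f)_k → M(f)_{k+1}`. -/
noncomputable def mulByLinearForm {n : ℕ} (f l : MvPolynomial (Fin n) ℂ)
    (hl : l.IsHomogeneous 1) (k : ℕ) : milnorPiece f k →ₗ[ℂ] milnorPiece f (k + 1) :=
  (LinearMap.mulLeft ℂ (Ideal.Quotient.mk (jacobianIdeal f) l)).restrict
    (mul_mem_milnorPiece f l hl k)

/-- The zero set of a homogeneous polynomial `f` in `n` variables in the projective space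
`ℙ(ℂⁿ)`. For homogeneous `f` the condition does not depend on the representative. -/
def projectiveZeros {n : ℕ} (f : MvPolynomial (Fin n) ℂ) :
    Set (Projectivization ℂ (Fin n → ℂ)) :=
  {p | eval p.rep f = 0}

/-- The singular locus of the projective hypersurface `f = 0`: the points of the hypersurface at
which all partial derivatives of `f` vanish. -/
def singularLocus {n : ℕ} (f : MvPolynomial (Fin n) ℂ) :
    Set (Projectivization ℂ (Fin n → ℂ)) :=
  {p | p ∈ projectiveZeros f ∧ ∀ i, p ∈ projectiveZeros (pderiv i f)}

/-- A hypersurface has isolated singularities if its singular locus is finite (possibly empty). -/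
def HasIsolatedSingularities {n : ℕ} (f : MvPolynomial (Fin n) ℂ) : Prop :=
  (singularLocus f).Finite

/-- The columns of the matrix `A` form a basis of the plane `l = 0`, viewed as a linear subspace of
`ℂ⁴`; equivalently `y ↦ A y` is a system of linear coordinates `y` on the projective plane
`H : l = 0` in `ℙ³`. -/
def IsCoordinateSystem (l : MvPolynomial (Fin 4) ℂ) (A : Matrix (Fin 4) (Fin 3) ℂ) : Prop :=
  Function.Injective A.mulVec ∧ Set.range A.mulVec = {v | eval v l = 0}

/-- The restriction `g(y) = f(A y)` of `f` to the plane parametrized by `A`. -/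
noncomputable def restrictToPlane (f : MvPolynomial (Fin 4) ℂ) (A : Matrix (Fin 4) (Fin 3) ℂ) :
    MvPolynomial (Fin 3) ℂ :=
  aeval (fun i => ∑ j, C (A i j) * X j) f

/-- The saturation `I(g)` of the Jacobian ideal `J(g)` with respect to the maximal ideal
`m` generated by the variables: all `c` with `m ^ N * c ⊆ J(g)` for some `N`. -/
noncomputable def saturatedJacobianIdeal {n : ℕ} (g : MvPolynomial (Fin n) ℂ) :
    Ideal (MvPolynomial (Fin n) ℂ) where
  carrier := {c | ∃ N : ℕ, ∀ b ∈ (Ideal.span (Set.range X) : Ideal (MvPolynomial (Fin n) ℂ)) ^ N,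
    b * c ∈ jacobianIdeal g}
  zero_mem' := ⟨0, fun b _ => by simp⟩
  add_mem' := by
    rintro c c' ⟨N, hN⟩ ⟨N', hN'⟩
    refine ⟨max N N', fun b hb => ?_⟩
    rw [mul_add]
    exact add_mem (hN b (Ideal.pow_le_pow_right (le_max_left N N') hb))
      (hN' b (Ideal.pow_le_pow_right (le_max_right N N') hb))
  smul_mem' := by
    rintro a c ⟨N, hN⟩
    refine ⟨N, fun b hb => ?_⟩
    rw [smul_eq_mul, mul_left_comm]
    exact Ideal.mul_mem_left _ a (hN b hb)

/-- The degree `k` piece `N(g)_k` of the Jacobian module `N(g) = I(g) / J(g) ⊆ M(g)`. -/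
noncomputable def jacobianModulePiece {n : ℕ} (g : MvPolynomial (Fin n) ℂ) (k : ℕ) :
    Submodule ℂ (MilnorAlgebra g) :=
  ((saturatedJacobianIdeal g).restrictScalars ℂ ⊓ homogeneousSubmodule (Fin n) ℂ k).map
    (Ideal.Quotient.mkₐ ℂ (jacobianIdeal g)).toLinearMap

/-- The module `Syz(g)` of first order syzygies `a` of the partial derivatives of `g`, that is
`∑ i, a i * ∂g/∂yᵢ = 0`. -/
noncomputable def syzygyModule {n : ℕ} (g : MvPolynomial (Fin n) ℂ) :
    Submodule (MvPolynomial (Fin n) ℂ) (Fin n → MvPolynomial (Fin n) ℂ) where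
  carrier := {a | ∑ i, a i * pderiv i g = 0}
  zero_mem' := by simp
  add_mem' := by
    intro a b ha hb
    simp only [Set.mem_ofPred_eq] at ha hb ⊢
    simp [add_mul, Finset.sum_add_distrib, ha, hb]
  smul_mem' := by
    intro c a ha
    simp only [Set.mem_ofPred_eq] at ha ⊢
    simp [mul_assoc, ← Finset.mul_sum, ha]

/-- A tuple of polynomials is homogeneous of degree `k` if all its entries are. -/
def IsHomogeneousTuple {n : ℕ} (a : Fin n → MvPolynomial (Fin n) ℂ) (k : ℕ) : Prop :=
  ∀ i, (a i).IsHomogeneous k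

/-- The reduced plane curve `g = 0` is free with exponents `(d₁, d₂)`: the graded module `Syz(g)`
is free, with a basis of two homogeneous elements of degrees `d₁` and `d₂`. -/
def IsFreeCurve (g : MvPolynomial (Fin 3) ℂ) (d₁ d₂ : ℕ) : Prop :=
  Squarefree g ∧
  ∃ b : Module.Basis (Fin 2) (MvPolynomial (Fin 3) ℂ) (syzygyModule g),
    IsHomogeneousTuple (b 0 : Fin 3 → MvPolynomial (Fin 3) ℂ) d₁ ∧
    IsHomogeneousTuple (b 1 : Fin 3 → MvPolynomial (Fin 3) ℂ) d₂

/-- The reduced plane curve `g = 0` is nearly free: `N(g) ≠ 0`, and every graded piece of `N(g)`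
has dimension at most one. -/
def IsNearlyFreeCurve (g : MvPolynomial (Fin 3) ℂ) : Prop :=
  Squarefree g ∧ saturatedJacobianIdeal g ≠ jacobianIdeal g ∧
  ∀ k, Module.rank ℂ (jacobianModulePiece g k) ≤ 1

/-- The exponents `(d₁, d₂)` of a nearly free curve: the graded module `Syz(g)` has a minimal
system of homogeneous generators consisting of three elements, of degrees `d₁`, `d₂`, `d₂`. -/
def HasNearlyFreeExponents (g : MvPolynomial (Fin 3) ℂ) (d₁ d₂ : ℕ) : Prop :=
  ∃ ρ : Fin 3 → Fin 3 → MvPolynomial (Fin 3) ℂ,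
    Submodule.span (MvPolynomial (Fin 3) ℂ) (Set.range ρ) = syzygyModule g ∧
    (∀ i, ρ i ∉ Submodule.span (MvPolynomial (Fin 3) ℂ) (ρ '' {j | j ≠ i})) ∧
    IsHomogeneousTuple (ρ 0) d₁ ∧ IsHomogeneousTuple (ρ 1) d₂ ∧ IsHomogeneousTuple (ρ 2) d₂

end JacobianLefschetz

/-! Write l q = ∑ a_i f_i. It suffices that every a_i vanishes on H, since then l divides each a_i
and cancels. On H the f_i span the same space as g_1, g_2, g_3 and a transversal derivative h, so
the restricted equation reads b₀ h + b · ∇g = 0, in degree e = k + 2 - d < d₁. If b₀ = 0, then b is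
a syzygy of degree below d₁, hence zero.

Let b₀ ≠ 0. As H avoids the singular points, the ideal (h, g_1, g_2, g_3) contains powers of all
variables (Nullstellensatz). So for each syzygy s, some power of each variable makes b₀ s a Koszul
syzygy ∇g × w. The partials of a squarefree form are coprime, which makes the Koszul syzygies
saturated: b₀ s itself is ∇g × w (`exists_smul_eq_cross`). Such a vector starts in degree d - 1, so
a nonzero s has degree at least d - 1 - e.

The generator of degree d₁ violates this once e + d₁ < d - 1. For free curves this follows from d₁ +
d₂ ≤ d - 1, for nearly free ones from d₁ + d₂ ≤ d, except when d₁ = d₂ and e + d₁ = d - 1; there w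
is constant and linear algebra decides (`false_of_relation_of_eq`).

Both bounds come from the minors c of the generators. In the nearly free case c is the relation
between them; entries of degree at least two would give, through local cohomology, two independent
classes in one piece of N(g). -/

open MvPolynomial Matrix

namespace JacobianLefschetz

/-! ### Coprime vectors and saturation of Koszul syzygies -/

section UniqueFactorization

variable {R : Type*} [CommRing R]

/-- The entries of `g` have no common prime factor. -/
def IsCoprimeTuple (g : Fin 3 → R) : Prop :=
  ∀ p, Prime p → ¬ ∀ i, p ∣ g i

theorem IsCoprimeTuple.ne_zero {g : Fin 3 → R} (hg : IsCoprimeTuple g) (h : ∃ p : R, Prime p) :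
    g ≠ 0 := by
  rintro rfl
  obtain ⟨p, hp⟩ := h
  exact hg p hp fun i => dvd_zero _

theorem exists_ne_zero_of_ne_zero {g : Fin 3 → R} (hg : g ≠ 0) : ∃ i, g i ≠ 0 := by
  by_contra! h
  exact hg (funext h)

theorem mul_eq_mul_of_cross_eq_zero {g u : Fin 3 → R} (h : crossProduct g u = 0) (i j : Fin 3) :
    g i * u j = g j * u i := by
  rw [cross_apply] at h
  have h0 := congrFun h 0
  have h1 := congrFun h 1
  have h2 := congrFun h 2
  simp at h0 h1 h2
  fin_cases i <;> fin_cases j <;> simp <;> grind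

variable [IsDomain R] [UniqueFactorizationMonoid R]

/-- Induction on the prime factors of `a`: each of them misses some `g j`, so it divides `u` and
cancels. -/
theorem IsCoprimeTuple.dvd_of_forall_dvd_mul {g : Fin 3 → R} (hg : IsCoprimeTuple g) (hg0 : g ≠ 0)
    (a : R) : ∀ u, (∀ j, a ∣ g j * u) → a ∣ u := by
  induction a using UniqueFactorizationMonoid.induction_on_prime with
  | h₁ =>
    intro u h
    obtain ⟨i, hi⟩ := exists_ne_zero_of_ne_zero hg0
    have := h i
    rw [zero_dvd_iff] at this ⊢
    exact (mul_eq_zero.1 this).resolve_left hi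
  | h₂ a ha => exact fun u _ => ha.dvd
  | h₃ a p ha hp ih =>
    intro u h
    have hpg := hg p hp
    push Not at hpg
    obtain ⟨j, hj⟩ := hpg
    obtain ⟨u', rfl⟩ : p ∣ u :=
      (hp.dvd_or_dvd ((dvd_mul_right p a).trans (h j))).resolve_left hj
    refine mul_dvd_mul_left p (ih u' fun i => ?_)
    have := h i
    rw [mul_left_comm] at this
    exact (mul_dvd_mul_iff_left hp.ne_zero).1 this

/-- A vector parallel to a coprime vector is a multiple of it. -/
theorem IsCoprimeTuple.exists_eq_smul {g : Fin 3 → R} (hg : IsCoprimeTuple g) (hg0 : g ≠ 0)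
    {u : Fin 3 → R} (h : crossProduct g u = 0) : ∃ c : R, u = c • g := by
  have h' := mul_eq_mul_of_cross_eq_zero h
  obtain ⟨i, hi⟩ := exists_ne_zero_of_ne_zero hg0
  obtain ⟨c, hc⟩ : g i ∣ u i :=
    hg.dvd_of_forall_dvd_mul hg0 _ _ fun j => ⟨u j, (h' i j).symm⟩
  refine ⟨c, funext fun j => mul_left_cancel₀ hi ?_⟩
  rw [h' i j, hc, Pi.smul_apply, smul_eq_mul]
  ring

/-- The Koszul complex of `x` is exact in its two middle terms. -/
structure IsKoszulExact (x : Fin 3 → R) : Prop where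
  ne_zero : ∀ i, x i ≠ 0
  exists_eq_smul : ∀ a, crossProduct x a = 0 → ∃ c : R, a = c • x
  exists_eq_cross : ∀ a, x ⬝ᵥ a = 0 → ∃ t, a = crossProduct x t

/-- The image of the cross product with a coprime vector is saturated with respect to a Koszul
exact sequence. -/
theorem IsKoszulExact.exists_eq_cross_of_forall {x g s : Fin 3 → R} (hx : IsKoszulExact x)
    (hg : IsCoprimeTuple g) (hg0 : g ≠ 0) (h : ∀ i, ∃ w, x i • s = crossProduct g w) :
    ∃ w, s = crossProduct g w := by
  choose w hw using h
  -- The rescaled lifts differ by an element of the kernel of `g ×`, which consists of the multiples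
  -- of `g`.
  have key : ∀ i j, ∃ c : R, x j • w i - x i • w j = c • g := fun i j => by
    apply hg.exists_eq_smul hg0
    rw [map_sub, map_smul, map_smul, ← hw, ← hw, smul_comm, sub_self]
  obtain ⟨c0, h0⟩ := key 1 2
  obtain ⟨c1, h1⟩ := key 2 0
  obtain ⟨c2, h2⟩ := key 0 1
  have hc : x ⬝ᵥ ![c0, c1, c2] = 0 := by
    obtain ⟨i, hi⟩ := exists_ne_zero_of_ne_zero hg0
    have e0 := congrFun h0 i
    have e1 := congrFun h1 i
    have e2 := congrFun h2 i
    simp at e0 e1 e2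
    refine (mul_eq_zero.1 (?_ : (x ⬝ᵥ ![c0, c1, c2]) * g i = 0)).resolve_right hi
    simp only [dotProduct, Fin.sum_univ_three, cons_val]
    linear_combination -x 0 * e0 - x 1 * e1 - x 2 * e2
  obtain ⟨e, he⟩ := hx.exists_eq_cross _ hc
  rw [cross_apply] at he
  have he0 := congrFun he 0
  have he1 := congrFun he 1
  have he2 := congrFun he 2
  simp at he0 he1 he2
  -- The coefficients form a Koszul cycle, hence a boundary; correcting `w i` by `e i • g` makes the
  -- lifts proportional to `x i`, with common quotient `W`.
  have hW : ∀ m, ∃ W : R, (fun i => w i m + e i * g m) = W • x := fun m => by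
    apply hx.exists_eq_smul
    have e0 := congrFun h0 m
    have e1 := congrFun h1 m
    have e2 := congrFun h2 m
    simp at e0 e1 e2
    rw [cross_apply]
    ext i
    fin_cases i <;> simp
    · linear_combination -e0 - g m * he0
    · linear_combination -e1 - g m * he1
    · linear_combination -e2 - g m * he2
  choose W hW using hW
  refine ⟨W, ?_⟩
  have hs : x 0 • s = x 0 • crossProduct g W := by
    rw [hw 0, ← map_smul]
    have : w 0 = x 0 • W - e 0 • g := by
      ext m
      have := congrFun (hW m) 0
      simp at this ⊢
      linear_combination this
    rw [this, map_sub, map_smul, map_smul, cross_self, smul_zero, sub_zero]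
  exact smul_right_injective _ (hx.ne_zero 0) hs

end UniqueFactorization

/-! ### Homogeneous components of products -/

section Homogeneous

variable {σ K : Type*} [CommSemiring K]

theorem coe_decompose_eq_homogeneousComponent (a : MvPolynomial σ K) (n : ℕ) :
    letI := gradedAlgebra (σ := σ) (R := K)
    (DirectSum.decompose (homogeneousSubmodule σ K) a n : MvPolynomial σ K) =
      homogeneousComponent n a :=
  decomposition.decompose'_apply a n

theorem homogeneousComponent_add_mul {i : ℕ} {a : MvPolynomial σ K} (ha : a.IsHomogeneous i)
    (j : ℕ) (b : MvPolynomial σ K) :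
    homogeneousComponent (i + j) (a * b) = a * homogeneousComponent j b := by
  classical
  let _ := gradedAlgebra (σ := σ) (R := K)
  have := DirectSum.coe_decompose_mul_add_of_left_mem (homogeneousSubmodule σ K)
    (i := i) (j := j) (b := b) ((mem_homogeneousSubmodule i a).2 ha)
  rwa [coe_decompose_eq_homogeneousComponent, coe_decompose_eq_homogeneousComponent] at this

theorem homogeneousComponent_mul_of_lt {i n : ℕ} {a : MvPolynomial σ K} (ha : a.IsHomogeneous i)
    (h : n < i) (b : MvPolynomial σ K) : homogeneousComponent n (a * b) = 0 := by
  classical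
  let _ := gradedAlgebra (σ := σ) (R := K)
  have := DirectSum.coe_decompose_mul_of_left_mem_of_not_le (homogeneousSubmodule σ K)
    (i := i) (n := n) (b := b) ((mem_homogeneousSubmodule i a).2 ha) h.not_ge
  rwa [coe_decompose_eq_homogeneousComponent] at this

end Homogeneous

/-! ### Powers of the variables as a regular sequence -/

section KoszulPowers

variable {K : Type*} [Field K]

theorem prime_X_fin (i : Fin 3) : Prime (X i : MvPolynomial (Fin 3) K) := X_prime

theorem isCoprimeTuple_X_pow (N : ℕ) :
    IsCoprimeTuple fun i => (X i : MvPolynomial (Fin 3) K) ^ N := by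
  intro p hp h
  have h0 := hp.dvd_of_dvd_pow (h 0)
  have h1 := hp.dvd_of_dvd_pow (h 1)
  have h01 := (hp.associated_of_dvd (prime_X_fin 0) h0).symm.dvd.trans h1
  simp [X_dvd_X] at h01

/-- Membership in a monomial ideal is tested on exponents, and those of the generators do not
involve `X 2`. -/
theorem exists_of_X_pow_mul_mem {N : ℕ} {a : MvPolynomial (Fin 3) K}
    (h : X 2 ^ N * a ∈ Ideal.span {(X 0 : MvPolynomial (Fin 3) K) ^ N, X 1 ^ N}) :
    a ∈ Ideal.span {(X 0 : MvPolynomial (Fin 3) K) ^ N, X 1 ^ N} := by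
  have hs : ({(X 0 : MvPolynomial (Fin 3) K) ^ N, X 1 ^ N} : Set (MvPolynomial (Fin 3) K)) =
      (fun s => monomial s (1 : K)) '' {Finsupp.single 0 N, Finsupp.single 1 N} := by
    simp [Set.image_pair, X_pow_eq_monomial]
  rw [hs, mem_ideal_span_monomial_image] at h ⊢
  intro m hm
  obtain ⟨s, hs, hle⟩ := h (Finsupp.single 2 N + m) (by
    rw [mem_support_iff, X_pow_eq_monomial, coeff_monomial_mul, one_mul]
    exact mem_support_iff.1 hm)
  refine ⟨s, hs, ?_⟩
  rcases hs with rfl | rfl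
  · rw [Finsupp.single_le_iff] at hle ⊢
    simpa using hle
  · rw [Finsupp.single_le_iff] at hle ⊢
    simpa using hle

theorem isKoszulExact_X_pow (N : ℕ) :
    IsKoszulExact fun i => (X i : MvPolynomial (Fin 3) K) ^ N where
  ne_zero i := pow_ne_zero _ (X_ne_zero i)
  exists_eq_smul a ha :=
    (isCoprimeTuple_X_pow N).exists_eq_smul
      ((isCoprimeTuple_X_pow N).ne_zero ⟨X 0, prime_X_fin 0⟩) ha
  exists_eq_cross a ha := by
    rw [dotProduct, Fin.sum_univ_three] at ha
    obtain ⟨p, q, hpq⟩ := Ideal.mem_span_pair.1 (exists_of_X_pow_mul_mem (N := N) (a := a 2) (by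
      rw [Ideal.mem_span_pair]
      exact ⟨-a 0, -a 1, by linear_combination -ha⟩))
    have h01 : ¬ (X 0 : MvPolynomial (Fin 3) K) ∣ X 1 ^ N := fun h => by
      have := (prime_X_fin 0).dvd_of_dvd_pow h
      simp [X_dvd_X] at this
    obtain ⟨r, hr⟩ := (prime_X_fin 0).pow_dvd_of_dvd_mul_left N h01
      (b := a 1 + X 2 ^ N * q) ⟨-(a 0 + X 2 ^ N * p), by
        linear_combination ha + X 2 ^ N * hpq⟩
    have h0 : a 0 + X 2 ^ N * p = -(X 1 ^ N * r) :=
      mul_left_cancel₀ (pow_ne_zero N (X_ne_zero 0))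
        (by linear_combination ha + X 2 ^ N * hpq - X 1 ^ N * hr)
    refine ⟨![-q, p, -r], ?_⟩
    rw [cross_apply]
    ext1 i
    fin_cases i <;> simp
    · linear_combination h0
    · linear_combination hr
    · linear_combination -hpq

/-- A multiple of a squarefree quadratic monomial by a form of degree at least two lies in the
ideal of the squares of the variables. -/
theorem exists_eq_sum_X_sq_mul {n : ℕ} {u : MvPolynomial (Fin 3) K} (hu : u.IsHomogeneous (n + 4)) :
    ∃ α : Fin 3 → MvPolynomial (Fin 3) K, (∀ v, (α v).IsHomogeneous (n + 2)) ∧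
      u = ∑ v, X v ^ 2 * α v := by
  have hmem : u ∈ Ideal.span (Set.range fun v => (X v : MvPolynomial (Fin 3) K) ^ 2) := by
    have hs : (Set.range fun v => (X v : MvPolynomial (Fin 3) K) ^ 2) =
        (fun s => monomial s (1 : K)) '' (Set.range fun v => Finsupp.single v 2) := by
      rw [← Set.range_comp]
      simp only [Function.comp_def, X_pow_eq_monomial]
    rw [hs, mem_ideal_span_monomial_image]
    intro m hm
    have hdeg : m.degree = n + 4 := by
      by_contra hne
      exact mem_support_iff.1 hm (hu.coeff_eq_zero hne)
    rw [Finsupp.degree_eq_sum, Fin.sum_univ_three] at hdeg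
    -- Three exponents below two add up to at most three.
    have : ∃ v, 2 ≤ m v := by
      by_contra! hlt
      have h0 := hlt 0
      have h1 := hlt 1
      have h2 := hlt 2
      omega
    obtain ⟨v, hv⟩ := this
    exact ⟨_, ⟨v, rfl⟩, Finsupp.single_le_iff.2 hv⟩
  obtain ⟨c, hc⟩ := (Ideal.mem_span_range_iff_exists_fun).1 hmem
  refine ⟨fun v => homogeneousComponent (n + 2) (c v),
    fun v => homogeneousComponent_isHomogeneous _ _, ?_⟩
  rw [← homogeneousComponent_eq_self hu, ← hc, map_sum]
  refine Finset.sum_congr rfl fun v _ => ?_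
  rw [mul_comm, ← homogeneousComponent_add_mul (isHomogeneous_X_pow v 2)]
  congr 2
  omega

theorem coeff_eq_zero_of_mem_span_X_sq {u : MvPolynomial (Fin 3) K}
    (hu : u ∈ Ideal.span (Set.range fun v => (X v : MvPolynomial (Fin 3) K) ^ 2))
    {m : Fin 3 →₀ ℕ} (hm : ∀ v, m v < 2) : u.coeff m = 0 := by
  have hs : (Set.range fun v => (X v : MvPolynomial (Fin 3) K) ^ 2) =
      (fun s => monomial s (1 : K)) '' (Set.range fun v => Finsupp.single v 2) := by
    rw [← Set.range_comp]
    simp only [Function.comp_def, X_pow_eq_monomial]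
  rw [hs, mem_ideal_span_monomial_image] at hu
  by_contra hne
  obtain ⟨_, ⟨v, rfl⟩, hv⟩ := hu m (mem_support_iff.2 hne)
  exact (hm v).not_ge (Finsupp.single_le_iff.1 hv)

end KoszulPowers

/-! ### Coprimality of the partial derivatives -/

section Gradient

variable {K : Type*} [Field K] [CharZero K]

/-- Characteristic zero keeps the derivative nonzero; the drop in degree prevents `p` from dividing
it. -/
theorem exists_pderiv_ne_zero {σ : Type*} {p : MvPolynomial σ K}
    (hp : p ∉ Set.range (C (σ := σ) (R := K))) :
    ∃ i, pderiv i p ≠ 0 ∧ degreeOf i (pderiv i p) < degreeOf i p := by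
  classical
  have : ∃ m ∈ p.support, m ≠ 0 := by
    by_contra! h
    refine hp ⟨p.coeff 0, ?_⟩
    ext m
    rw [coeff_C]
    split_ifs with hm
    · rw [hm]
    · by_contra hne
      exact hm (h m (mem_support_iff.2 (Ne.symm hne))).symm
  obtain ⟨m, hm, hm0⟩ := this
  obtain ⟨i, hi⟩ := Finsupp.ne_iff.1 hm0
  rw [Finsupp.zero_apply] at hi
  refine ⟨i, fun h0 => ?_, ?_⟩
  · have := congrArg (coeff (m - Finsupp.single i 1)) h0
    have hle : Finsupp.single i 1 ≤ m := Finsupp.single_le_iff.2 (Nat.one_le_iff_ne_zero.2 hi)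
    rw [coeff_pderiv, tsub_add_cancel_of_le hle, coeff_zero] at this
    rcases mul_eq_zero.1 this with h | h
    · exact mem_support_iff.1 hm h
    · exact Nat.cast_add_one_ne_zero _ h
  · have hpos : 0 < degreeOf i p := (Nat.pos_of_ne_zero hi).trans_le
      (le_degreeOf_of_mem_support i hm)
    rw [degreeOf_lt_iff hpos]
    intro n hn
    have : n + Finsupp.single i 1 ∈ p.support := by
      rw [mem_support_iff] at hn ⊢
      rw [coeff_pderiv] at hn
      exact left_ne_zero_of_mul hn
    have := le_degreeOf_of_mem_support i this
    simp at this
    omega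

/-- The partial derivatives of a squarefree form have no common factor. -/
theorem isCoprimeTuple_pderiv {g : MvPolynomial (Fin 3) K} {d : ℕ} (hd : d ≠ 0)
    (hg : g.IsHomogeneous d) (hsq : Squarefree g) : IsCoprimeTuple fun i => pderiv i g := by
  intro p hp h
  -- Euler's formula.
  have hpg : p ∣ g := by
    have h1 : p ∣ d • g := by
      rw [← hg.sum_X_mul_pderiv]
      exact Finset.dvd_sum fun i _ => (h i).mul_left _
    rw [nsmul_eq_mul, ← map_natCast (C (σ := Fin 3) (R := K))] at h1
    exact (IsUnit.dvd_mul_left ((isUnit_iff_ne_zero.2 (Nat.cast_ne_zero.2 hd)).map C)).1 h1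
  obtain ⟨q, rfl⟩ := hpg
  obtain ⟨i, hi0, hi⟩ := exists_pderiv_ne_zero (p := p) (by
    rintro ⟨c, rfl⟩
    have hc : c ≠ 0 := by
      rintro rfl
      exact hp.ne_zero (map_zero C)
    exact hp.not_isUnit ((isUnit_iff_ne_zero.2 hc).map C))
  have h2 : p ∣ pderiv i p * q := by
    have : p ∣ pderiv i (p * q) := h i
    rw [pderiv_mul] at this
    exact (dvd_add_left (dvd_mul_right p _)).1 this
  rcases hp.dvd_or_dvd h2 with ⟨r, hr⟩ | h3
  · have hr0 : r ≠ 0 := by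
      rintro rfl
      exact hi0 (by rw [hr, mul_zero])
    rw [hr, degreeOf_mul_eq hp.ne_zero hr0] at hi
    omega
  · exact hp.not_isUnit (hsq p (mul_dvd_mul_left p h3))

end Gradient

/-! ### Graded pieces of vectors -/

section HomogeneousTuple

/-- The homogeneous component of degree `k` of a tuple of polynomials. -/
noncomputable def tupleComponent (k : ℕ) (a : Fin 3 → MvPolynomial (Fin 3) ℂ) :
    Fin 3 → MvPolynomial (Fin 3) ℂ :=
  fun i => homogeneousComponent k (a i)

theorem isHomogeneousTuple_tupleComponent (k : ℕ) (a : Fin 3 → MvPolynomial (Fin 3) ℂ) :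
    IsHomogeneousTuple (tupleComponent k a) k :=
  fun i => homogeneousComponent_isHomogeneous k (a i)

variable {a b : Fin 3 → MvPolynomial (Fin 3) ℂ} {k n : ℕ}

theorem IsHomogeneousTuple.tupleComponent_eq (ha : IsHomogeneousTuple a k) :
    tupleComponent k a = a :=
  funext fun i => homogeneousComponent_eq_self (ha i)

theorem IsHomogeneousTuple.cross (ha : IsHomogeneousTuple a k) (hb : IsHomogeneousTuple b n) :
    IsHomogeneousTuple (crossProduct a b) (k + n) := by
  rw [cross_apply]
  intro i
  fin_cases i <;> exact ((ha _).mul (hb _)).sub ((ha _).mul (hb _))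

theorem IsHomogeneousTuple.smul {c : MvPolynomial (Fin 3) ℂ} (hc : c.IsHomogeneous k)
    (ha : IsHomogeneousTuple a n) : IsHomogeneousTuple (c • a) (k + n) :=
  fun i => hc.mul (ha i)

theorem IsHomogeneousTuple.tupleComponent_cross (ha : IsHomogeneousTuple a k) (n : ℕ)
    (w : Fin 3 → MvPolynomial (Fin 3) ℂ) :
    tupleComponent (k + n) (crossProduct a w) = crossProduct a (tupleComponent n w) := by
  ext1 i
  simp only [tupleComponent, cross_apply]
  fin_cases i <;> simp [homogeneousComponent_add_mul (ha _)]

theorem IsHomogeneousTuple.tupleComponent_cross_of_lt (ha : IsHomogeneousTuple a k) (h : n < k)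
    (w : Fin 3 → MvPolynomial (Fin 3) ℂ) : tupleComponent n (crossProduct a w) = 0 := by
  ext1 i
  simp only [tupleComponent, cross_apply]
  fin_cases i <;> simp [homogeneousComponent_mul_of_lt (ha _) h]

theorem IsHomogeneousTuple.isHomogeneous_of_smul (ha : IsHomogeneousTuple a k) (ha0 : a ≠ 0)
    {c : MvPolynomial (Fin 3) ℂ} (h : IsHomogeneousTuple (c • a) (k + n)) : c.IsHomogeneous n := by
  obtain ⟨i, hi⟩ := exists_ne_zero_of_ne_zero ha0
  have h1 := homogeneousComponent_eq_self (h i)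
  rw [Pi.smul_apply, smul_eq_mul, mul_comm, homogeneousComponent_add_mul (ha i)] at h1
  rw [← mul_left_cancel₀ hi h1]
  exact homogeneousComponent_isHomogeneous n c

end HomogeneousTuple

/-! ### Minors of generating syzygies, in the manner of Hilbert–Burch -/

section SyzygyMinors

variable {R : Type*} [CommRing R]

/-- The Cauchy–Binet formula for 2 × 2 minors. -/
theorem cross_eq_sum_smul_cross {ρ : Fin 3 → Fin 3 → R} {s t a b : Fin 3 → R}
    (hs : s = ∑ l, a l • ρ l) (ht : t = ∑ l, b l • ρ l) :
    crossProduct s t = crossProduct a b 0 • crossProduct (ρ 1) (ρ 2) +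
      crossProduct a b 1 • crossProduct (ρ 2) (ρ 0) +
      crossProduct a b 2 • crossProduct (ρ 0) (ρ 1) := by
  subst hs ht
  simp only [cross_apply, Fin.sum_univ_three]
  ext1 i
  fin_cases i <;> simp <;> ring

theorem cross_cross_eq_zero {g s t : Fin 3 → R} (hs : s ⬝ᵥ g = 0) (ht : t ⬝ᵥ g = 0) :
    crossProduct g (crossProduct s t) = 0 := by
  simp only [dotProduct, Fin.sum_univ_three] at hs ht
  simp only [cross_apply]
  ext1 i
  fin_cases i <;> simp
  · linear_combination s 0 * ht - t 0 * hs
  · linear_combination s 1 * ht - t 1 * hs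
  · linear_combination s 2 * ht - t 2 * hs

/-- `c` is the tuple of maximal minors of `ρ`, divided by `g`. -/
structure IsMinorTuple (g : Fin 3 → R) (ρ : Fin 3 → Fin 3 → R) (c : Fin 3 → R) : Prop where
  cross_one_two : crossProduct (ρ 1) (ρ 2) = c 0 • g
  cross_two_zero : crossProduct (ρ 2) (ρ 0) = c 1 • g
  cross_zero_one : crossProduct (ρ 0) (ρ 1) = c 2 • g

/-- `ρ` generates the module of syzygies of `g`. -/
structure GeneratesSyzygies (g : Fin 3 → R) (ρ : Fin 3 → Fin 3 → R) : Prop where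
  dotProduct_eq_zero : ∀ i, ρ i ⬝ᵥ g = 0
  exists_eq_sum : ∀ s, s ⬝ᵥ g = 0 → ∃ a : Fin 3 → R, s = ∑ l, a l • ρ l

variable {g : Fin 3 → R} {ρ : Fin 3 → Fin 3 → R} {c : Fin 3 → R}

theorem IsMinorTuple.cross_eq (hc : IsMinorTuple g ρ c) {s t a b : Fin 3 → R}
    (hs : s = ∑ l, a l • ρ l) (ht : t = ∑ l, b l • ρ l) :
    crossProduct s t = (crossProduct a b ⬝ᵥ c) • g := by
  rw [cross_eq_sum_smul_cross hs ht, hc.cross_one_two, hc.cross_two_zero, hc.cross_zero_one,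
    dotProduct, Fin.sum_univ_three]
  module

variable [IsDomain R]

/-- Crossing the relation `u` with each `ρ i` gives `(u × e_i) · c = 0`, so every relation is
parallel to `c`. -/
theorem IsMinorTuple.cross_eq_zero_of_sum_smul_eq_zero (hg0 : g ≠ 0) (hc : IsMinorTuple g ρ c)
    {u : Fin 3 → R} (hu : ∑ l, u l • ρ l = 0) : crossProduct c u = 0 := by
  obtain ⟨j, hj⟩ := exists_ne_zero_of_ne_zero hg0
  have key : ∀ i, crossProduct u (Pi.single i 1) ⬝ᵥ c = 0 := fun i => by
    have h1 := hc.cross_eq hu.symm (t := ρ i) (b := Pi.single i 1)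
      (by simp [Pi.single_apply, ite_smul])
    rw [map_zero, LinearMap.zero_apply] at h1
    have h2 := congrFun h1 j
    simp only [Pi.zero_apply, Pi.smul_apply, smul_eq_mul] at h2
    exact (mul_eq_zero.1 h2.symm).resolve_right hj
  have k0 := key 0
  have k1 := key 1
  have k2 := key 2
  simp [cross_apply, dotProduct, Fin.sum_univ_three] at k0 k1 k2
  rw [cross_apply]
  ext1 i
  fin_cases i <;> simp
  · linear_combination k0
  · linear_combination k1
  · linear_combination k2

/-- Cramer's rule: the rows `ρ i` are all orthogonal to `g`, so their determinant vanishes and the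
minors give a relation. -/
theorem IsMinorTuple.sum_smul_eq_zero (hg0 : g ≠ 0) (hc : IsMinorTuple g ρ c)
    (hρ : ∀ i, ρ i ⬝ᵥ g = 0) : ∑ l, c l • ρ l = 0 := by
  obtain ⟨j, hj⟩ := exists_ne_zero_of_ne_zero hg0
  have e0 := hc.cross_one_two
  have e1 := hc.cross_two_zero
  have e2 := hc.cross_zero_one
  have hdet : ρ 0 ⬝ᵥ crossProduct (ρ 1) (ρ 2) = 0 := by
    rw [e0, dotProduct_smul, hρ, smul_zero]
  simp only [cross_apply] at e0 e1 e2 hdet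
  have e0' := congrFun e0 j
  have e1' := congrFun e1 j
  have e2' := congrFun e2 j
  simp [dotProduct, Fin.sum_univ_three] at hdet
  ext1 i
  refine (mul_eq_zero.1 (?_ : (∑ l, c l • ρ l) i * g j = 0)).resolve_right hj
  simp only [Fin.sum_univ_three, Pi.add_apply, Pi.smul_apply, smul_eq_mul]
  fin_cases i <;> fin_cases j <;> simp at e0' e1' e2' ⊢ <;>
    rw [← mul_eq_zero] <;> grind

variable [UniqueFactorizationMonoid R]

/-- Coprimality of `c` is tested on the Koszul syzygies: `(g × v) × (g × w) = det(g, v, w) g`, so a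
common prime of the minors divides every `det(g, v, w)`, in particular every entry of `g`. -/
theorem exists_isMinorTuple (hg : IsCoprimeTuple g) (hg0 : g ≠ 0) (hρ : GeneratesSyzygies g ρ) :
    ∃ c, IsMinorTuple g ρ c ∧ IsCoprimeTuple c := by
  have key : ∀ i j, ∃ c : R, crossProduct (ρ i) (ρ j) = c • g := fun i j =>
    hg.exists_eq_smul hg0
      (cross_cross_eq_zero (hρ.dotProduct_eq_zero i) (hρ.dotProduct_eq_zero j))
  obtain ⟨c0, h0⟩ := key 1 2
  obtain ⟨c1, h1⟩ := key 2 0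
  obtain ⟨c2, h2⟩ := key 0 1
  have hc : IsMinorTuple g ρ ![c0, c1, c2] := ⟨h0, h1, h2⟩
  refine ⟨_, hc, fun p hp hdvd => hg p hp ?_⟩
  obtain ⟨j, hj⟩ := exists_ne_zero_of_ne_zero hg0
  have hk : ∀ v, ∃ a : Fin 3 → R, crossProduct g v = ∑ l, a l • ρ l := fun v =>
    hρ.exists_eq_sum _ (by rw [dotProduct_comm, dot_self_cross])
  have main : ∀ v w, p ∣ g ⬝ᵥ crossProduct v w := fun v w => by
    obtain ⟨a, ha⟩ := hk v
    obtain ⟨b, hb⟩ := hk w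
    have h := hc.cross_eq ha hb
    have h' : crossProduct (crossProduct g v) (crossProduct g w) =
        (g ⬝ᵥ crossProduct v w) • g := by
      simp only [cross_apply, dotProduct, Fin.sum_univ_three]
      ext1 i
      fin_cases i <;> simp <;> ring
    rw [h'] at h
    have := mul_right_cancel₀ hj (congrFun h j)
    rw [this]
    exact Finset.dvd_sum fun i _ => (hdvd i).mul_left _
  intro i
  fin_cases i
  · simpa [cross_apply, dotProduct, Fin.sum_univ_three] using main ![0, 1, 0] ![0, 0, 1]
  · simpa [cross_apply, dotProduct, Fin.sum_univ_three] using main ![0, 0, 1] ![1, 0, 0]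
  · simpa [cross_apply, dotProduct, Fin.sum_univ_three] using main ![1, 0, 0] ![0, 1, 0]

end SyzygyMinors

/-! ### Multiples of syzygies that are Koszul -/

section Saturation

theorem exists_smul_eq_cross {g b s : Fin 3 → MvPolynomial (Fin 3) ℂ}
    {h b₀ : MvPolynomial (Fin 3) ℂ} (hg : IsCoprimeTuple g) (hg0 : g ≠ 0) {N : ℕ}
    (hN : ∀ i, ∃ (c : MvPolynomial (Fin 3) ℂ) (v : Fin 3 → MvPolynomial (Fin 3) ℂ),
      X i ^ N = c * h + v ⬝ᵥ g)
    (hb : b₀ * h + b ⬝ᵥ g = 0) (hs : s ⬝ᵥ g = 0) : ∃ w, b₀ • s = crossProduct g w := by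
  refine (isKoszulExact_X_pow N).exists_eq_cross_of_forall hg hg0 fun i => ?_
  obtain ⟨c, v, hcv⟩ := hN i
  -- With `p = b₀ v - c b` the relation gives `b₀ X_i^N = p · g`, and `(p · g) s = g × (s × p)`
  -- because `s · g = 0`.
  refine ⟨c • crossProduct b s - b₀ • crossProduct v s, ?_⟩
  rw [hcv]
  simp only [dotProduct, Fin.sum_univ_three] at hb hs ⊢
  simp only [cross_apply]
  ext1 j
  fin_cases j <;> simp
  · linear_combination c * s 0 * hb + (b₀ * v 0 - c * b 0) * hs
  · linear_combination c * s 1 * hb + (b₀ * v 1 - c * b 1) * hs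
  · linear_combination c * s 2 * hb + (b₀ * v 2 - c * b 2) * hs

end Saturation

/-! ### Degree bound for free curves -/

section FreeDegrees

theorem exists_prime_dvd_of_isHomogeneous {a : MvPolynomial (Fin 3) ℂ} {e : ℕ}
    (ha : a.IsHomogeneous e) (ha0 : a ≠ 0) (he : e ≠ 0) : ∃ p, Prime p ∧ p ∣ a := by
  have hu : ¬ IsUnit a := fun hu => by
    refine (hu.map (constantCoeff (R := ℂ) (σ := Fin 3))).ne_zero ?_
    exact ha.coeff_eq_zero (by simpa using he.symm)
  obtain ⟨p, hp, hdvd⟩ := WfDvdMonoid.exists_irreducible_factor hu ha0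
  exact ⟨p, hp.prime, hdvd⟩

variable {g : Fin 3 → MvPolynomial (Fin 3) ℂ} {ρ : Fin 3 → Fin 3 → MvPolynomial (Fin 3) ℂ} {m : ℕ}

theorem GeneratesSyzygies.eq_zero_of_isHomogeneousTuple (hρ : GeneratesSyzygies g ρ)
    {D : Fin 3 → ℕ} (hD : ∀ i, IsHomogeneousTuple (ρ i) (D i))
    {s : Fin 3 → MvPolynomial (Fin 3) ℂ} {e : ℕ} (he : ∀ i, e < D i) (hs : IsHomogeneousTuple s e)
    (hsg : s ⬝ᵥ g = 0) : s = 0 := by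
  obtain ⟨a, ha⟩ := hρ.exists_eq_sum s hsg
  ext1 i
  rw [← homogeneousComponent_eq_self (hs i), ha, Finset.sum_apply, map_sum]
  refine Finset.sum_eq_zero fun l _ => ?_
  rw [Pi.smul_apply, smul_eq_mul, mul_comm, homogeneousComponent_mul_of_lt (hD l i) (he l)]

/-- The degrees of a homogeneous basis of the module of syzygies add up to at most the
degree of `g`. -/
theorem GeneratesSyzygies.degree_add_le (hg : IsCoprimeTuple g) (hg0 : g ≠ 0)
    (hgm : IsHomogeneousTuple g m) (hρ : GeneratesSyzygies g ρ) (h2 : ρ 2 = 0) {d₁ d₂ : ℕ}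
    (h0 : IsHomogeneousTuple (ρ 0) d₁) (h1 : IsHomogeneousTuple (ρ 1) d₂) : d₁ + d₂ ≤ m := by
  obtain ⟨c, hc, hcop⟩ := exists_isMinorTuple hg hg0 hρ
  obtain ⟨j, hj⟩ := exists_ne_zero_of_ne_zero hg0
  have c0 : c 0 = 0 := by
    have := congrFun hc.cross_one_two j
    rw [h2, map_zero] at this
    exact (mul_eq_zero.1 this.symm).resolve_right hj
  have c1 : c 1 = 0 := by
    have := congrFun hc.cross_two_zero j
    rw [h2, map_zero] at this
    exact (mul_eq_zero.1 this.symm).resolve_right hj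
  -- Now `c 2` is the only entry of `c` that can be nonzero, and it is zero or a form of positive
  -- degree; either way a prime divides all of `c`.
  by_contra! hlt
  have hdeg : IsHomogeneousTuple (c 2 • g) (m + (d₁ + d₂ - m)) := by
    rw [← hc.cross_zero_one, Nat.add_sub_cancel' hlt.le]
    exact h0.cross h1
  have hc2 := hgm.isHomogeneous_of_smul hg0 hdeg
  have hp : ∃ p, Prime p ∧ p ∣ c 2 := by
    by_cases hz : c 2 = 0
    · exact ⟨X 0, X_prime, hz ▸ dvd_zero _⟩
    · exact exists_prime_dvd_of_isHomogeneous hc2 hz (by omega)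
  obtain ⟨p, hp, hdvd⟩ := hp
  refine hcop p hp fun i => ?_
  fin_cases i
  · simp [c0]
  · simp [c1]
  · exact hdvd

end FreeDegrees

/-! ### The connecting map from H³ of the relations to N(g) -/

section ConnectingMap

/-- The squares of the three variables. -/
noncomputable abbrev squares : Fin 3 → MvPolynomial (Fin 3) ℂ := fun v => X v ^ 2

/-- `c` represents the image of the class of `q / (X₀²X₁²X₂²)` under the connecting map from the
local cohomology of the relations between the generators `ρ` of the syzygies of `g` to the
zeroth local cohomology of the quotient by the ideal generated by `g`. -/
def IsConnectingImage (g : Fin 3 → MvPolynomial (Fin 3) ℂ)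
    (ρ : Fin 3 → Fin 3 → MvPolynomial (Fin 3) ℂ) (c : Fin 3 → MvPolynomial (Fin 3) ℂ)
    (q u : MvPolynomial (Fin 3) ℂ) : Prop :=
  ∃ α τ : Fin 3 → Fin 3 → MvPolynomial (Fin 3) ℂ,
    (∀ l, q * c l = squares ⬝ᵥ α l) ∧
    (∀ m, ∑ l, ρ l m • α l = crossProduct squares (τ m)) ∧
    ∑ m, g m • τ m = u • squares

variable {g : Fin 3 → MvPolynomial (Fin 3) ℂ} {ρ : Fin 3 → Fin 3 → MvPolynomial (Fin 3) ℂ}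
  {c : Fin 3 → MvPolynomial (Fin 3) ℂ}

theorem IsConnectingImage.add {q q' u u' : MvPolynomial (Fin 3) ℂ}
    (h : IsConnectingImage g ρ c q u) (h' : IsConnectingImage g ρ c q' u') :
    IsConnectingImage g ρ c (q + q') (u + u') := by
  obtain ⟨α, τ, h1, h2, h3⟩ := h
  obtain ⟨α', τ', h1', h2', h3'⟩ := h'
  refine ⟨α + α', τ + τ', fun l => ?_, fun m => ?_, ?_⟩
  · rw [add_mul, h1, h1', Pi.add_apply, dotProduct_add]
  · simp only [Pi.add_apply, smul_add, Finset.sum_add_distrib, h2, h2', map_add]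
  · simp only [Pi.add_apply, smul_add, Finset.sum_add_distrib, h3, h3', add_smul]

theorem IsConnectingImage.mul_left {q u : MvPolynomial (Fin 3) ℂ}
    (h : IsConnectingImage g ρ c q u) (a : MvPolynomial (Fin 3) ℂ) :
    IsConnectingImage g ρ c (a * q) (a * u) := by
  obtain ⟨α, τ, h1, h2, h3⟩ := h
  refine ⟨a • α, a • τ, fun l => ?_, fun m => ?_, ?_⟩
  · rw [mul_assoc, h1, Pi.smul_apply, dotProduct_smul, smul_eq_mul]
  · simp only [Pi.smul_apply, smul_comm _ a, ← Finset.smul_sum, h2, map_smul]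
  · simp only [Pi.smul_apply, smul_comm _ a, ← Finset.smul_sum, h3, mul_smul]

theorem IsConnectingImage.sq_mul_mem {q u : MvPolynomial (Fin 3) ℂ}
    (h : IsConnectingImage g ρ c q u) (v : Fin 3) : X v ^ 2 * u ∈ Ideal.span (Set.range g) := by
  obtain ⟨α, τ, h1, h2, h3⟩ := h
  have := congrFun h3 v
  rw [Finset.sum_apply, Pi.smul_apply, smul_eq_mul, mul_comm u] at this
  rw [← this]
  exact Ideal.sum_mem _ fun m _ => Ideal.mul_mem_right _ _ (Ideal.subset_span ⟨m, rfl⟩)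

/-- The connecting map is injective. -/
theorem IsConnectingImage.mem_of_mem (hg0 : g ≠ 0)
    (hρ : GeneratesSyzygies g ρ) (hc : IsMinorTuple g ρ c) (hcop : IsCoprimeTuple c)
    {q u : MvPolynomial (Fin 3) ℂ} (h : IsConnectingImage g ρ c q u)
    (hu : u ∈ Ideal.span (Set.range g)) : q ∈ Ideal.span (Set.range squares) := by
  have hc0 : c ≠ 0 := hcop.ne_zero ⟨X 0, X_prime⟩
  obtain ⟨α, τ, h1, h2, h3⟩ := h
  obtain ⟨θ, hθ⟩ := Ideal.mem_span_range_iff_exists_fun.1 hu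
  -- Writing `u = θ · g` turns each column of `τ - θ ⊗ squares` into a syzygy; its coefficients `η`
  -- correct `α` by a Koszul boundary to a relation between the `ρ l`, hence a multiple of `c`.
  have hη : ∀ v, ∃ a : Fin 3 → MvPolynomial (Fin 3) ℂ,
      (fun m => τ m v - θ m * X v ^ 2) = ∑ l, a l • ρ l := fun v => by
    apply hρ.exists_eq_sum
    have := congrFun h3 v
    simp only [Fin.sum_univ_three, Pi.add_apply, Pi.smul_apply, smul_eq_mul] at this hθ
    simp only [dotProduct, Fin.sum_univ_three]
    linear_combination this - X v ^ 2 * hθ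
  choose η hη using hη
  have hκ : ∀ v, ∃ κ : MvPolynomial (Fin 3) ℂ,
      (fun l => α l v - crossProduct squares (fun w => η w l) v) = κ • c := fun v => by
    apply hcop.exists_eq_smul hc0
    apply hc.cross_eq_zero_of_sum_smul_eq_zero hg0
    ext1 m
    have e0 := congrFun (hη 0) m
    have e1 := congrFun (hη 1) m
    have e2 := congrFun (hη 2) m
    have e := congrFun (h2 m) v
    simp only [cross_apply, Fin.sum_univ_three, Pi.add_apply, Pi.smul_apply, smul_eq_mul] at *
    fin_cases v <;> simp at e ⊢
    · linear_combination e + X 1 ^ 2 * e2 - X 2 ^ 2 * e1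
    · linear_combination e + X 2 ^ 2 * e0 - X 0 ^ 2 * e2
    · linear_combination e + X 0 ^ 2 * e1 - X 1 ^ 2 * e0
  choose κ hκ using hκ
  obtain ⟨l, hl⟩ := exists_ne_zero_of_ne_zero hc0
  -- Pairing with `squares` kills the boundary and leaves `q c l = (∑ κ v X_v²) c l`.
  have hq : q = ∑ v, κ v * X v ^ 2 := by
    refine mul_right_cancel₀ hl ?_
    have e0 := congrFun (hκ 0) l
    have e1 := congrFun (hκ 1) l
    have e2 := congrFun (hκ 2) l
    rw [h1]
    simp [cross_apply] at e0 e1 e2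
    simp only [dotProduct, Fin.sum_univ_three]
    linear_combination X 0 ^ 2 * e0 + X 1 ^ 2 * e1 + X 2 ^ 2 * e2
  rw [hq]
  exact Ideal.sum_mem _ fun v _ => Ideal.mul_mem_left _ _ (Ideal.subset_span ⟨v, rfl⟩)

theorem isHomogeneousTuple_squares : IsHomogeneousTuple squares 2 :=
  fun v => isHomogeneous_X_pow v 2

/-- If the relation between the generators has entries of degree at least two, then all classes
of quadratic monomials have a homogeneous image under the connecting map. -/
theorem exists_isConnectingImage (hg0 : g ≠ 0) {m' : ℕ} (hgm : IsHomogeneousTuple g (m' + 2))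
    (hρ : GeneratesSyzygies g ρ) (hc : IsMinorTuple g ρ c) {n D : Fin 3 → ℕ} {t : ℕ}
    (hn : ∀ l, (c l).IsHomogeneous (n l + 2)) (hD : ∀ l, IsHomogeneousTuple (ρ l) (D l))
    (ht : ∀ l, n l + D l = t) {q : MvPolynomial (Fin 3) ℂ} (hq : q.IsHomogeneous 2) :
    ∃ u : MvPolynomial (Fin 3) ℂ, u.IsHomogeneous (t + m') ∧ IsConnectingImage g ρ c q u := by
  have hK : IsKoszulExact squares := isKoszulExact_X_pow (K := ℂ) 2
  have hα : ∀ l, ∃ a, IsHomogeneousTuple a (n l + 2) ∧ q * c l = squares ⬝ᵥ a := fun l =>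
    exists_eq_sum_X_sq_mul (by simpa [add_comm, add_left_comm] using hq.mul (hn l))
  choose α hαh hα using hα
  have hτ : ∀ m, ∃ t', ∑ l, ρ l m • α l = crossProduct squares t' := fun m => by
    apply hK.exists_eq_cross
    have h := congrFun (hc.sum_smul_eq_zero hg0 hρ.dotProduct_eq_zero) m
    rw [Finset.sum_apply] at h
    simp only [dotProduct_sum, dotProduct_smul, ← hα, smul_eq_mul]
    calc ∑ l, ρ l m * (q * c l) = q * ∑ l, (c l • ρ l) m := by
          rw [Finset.mul_sum]
          exact Finset.sum_congr rfl fun l _ => by rw [Pi.smul_apply, smul_eq_mul]; ring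
      _ = 0 := by rw [h, Pi.zero_apply, mul_zero]
  choose τ' hτ' using hτ
  have hτ : ∀ m, ∑ l, ρ l m • α l = crossProduct squares (tupleComponent t (τ' m)) := fun m => by
    rw [← isHomogeneousTuple_squares.tupleComponent_cross, ← hτ',
      IsHomogeneousTuple.tupleComponent_eq]
    intro v
    rw [Finset.sum_apply]
    refine IsHomogeneous.sum _ _ _ fun l _ => ?_
    rw [Pi.smul_apply, smul_eq_mul, show 2 + t = D l + (n l + 2) by rw [← ht l]; ring]
    exact (hD l m).mul (hαh l v)
  -- The cross product with `squares` vanishes since each `ρ l` is a syzygy of `g`.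
  obtain ⟨u, hu⟩ := hK.exists_eq_smul (∑ m, g m • tupleComponent t (τ' m)) (by
    simp only [map_sum, map_smul, ← hτ, Finset.smul_sum]
    rw [Finset.sum_comm]
    refine Finset.sum_eq_zero fun l _ => ?_
    have h := hρ.dotProduct_eq_zero l
    simp only [dotProduct] at h
    simp only [smul_smul, ← Finset.sum_smul, mul_comm (g _)]
    rw [h, zero_smul])
  refine ⟨u, ?_, α, fun m => tupleComponent t (τ' m), hα, hτ, hu⟩
  refine isHomogeneousTuple_squares.isHomogeneous_of_smul (hK.ne_zero 0 <| congrFun · 0) ?_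
  rw [← hu]
  intro v
  rw [Finset.sum_apply]
  refine IsHomogeneous.sum _ _ _ fun m _ => ?_
  rw [Pi.smul_apply, smul_eq_mul, show 2 + (t + m') = (m' + 2) + t by ring]
  exact (hgm m).mul (isHomogeneousTuple_tupleComponent t (τ' m) v)

end ConnectingMap

/-! ### Degree bound for nearly free curves -/

section NearlyFreeDegrees

theorem mem_saturatedJacobianIdeal {g u : MvPolynomial (Fin 3) ℂ}
    (h : ∀ v, X v ^ 2 * u ∈ jacobianIdeal g) : u ∈ saturatedJacobianIdeal g := by
  have hle : (Ideal.span (Set.range X) : Ideal (MvPolynomial (Fin 3) ℂ)) ≤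
      ((jacobianIdeal g).colon {u}).radical := by
    rw [Ideal.span_le]
    rintro _ ⟨v, rfl⟩
    exact ⟨2, by simpa [Submodule.mem_colon_singleton] using h v⟩
  obtain ⟨N, hN⟩ := Ideal.exists_pow_le_of_le_radical_of_fg hle (Ideal.fg_of_isNoetherianRing _)
  exact ⟨N, fun b hb => by simpa [Submodule.mem_colon_singleton] using hN hb⟩

/-- If the graded pieces of the Jacobian module are at most one-dimensional, then two elements of
the saturation of the same degree are linearly dependent modulo the Jacobian ideal. -/
theorem exists_smul_add_smul_mem {g : MvPolynomial (Fin 3) ℂ} {k : ℕ}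
    (hrank : Module.rank ℂ (jacobianModulePiece g k) ≤ 1) {u u' : MvPolynomial (Fin 3) ℂ}
    (hu : u ∈ saturatedJacobianIdeal g) (hu' : u' ∈ saturatedJacobianIdeal g)
    (hk : u.IsHomogeneous k) (hk' : u'.IsHomogeneous k) :
    ∃ a a' : ℂ, (a ≠ 0 ∨ a' ≠ 0) ∧ C a * u + C a' * u' ∈ jacobianIdeal g := by
  obtain ⟨v, hv⟩ := rank_le_one_iff.1 hrank
  have key : ∀ w, w ∈ saturatedJacobianIdeal g → w.IsHomogeneous k →
      ∃ r : ℂ, r • (v : MilnorAlgebra g) = Ideal.Quotient.mk _ w := fun w hw hwk => by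
    obtain ⟨r, hr⟩ := hv ⟨Ideal.Quotient.mk _ w, w, ⟨hw, hwk⟩, rfl⟩
    exact ⟨r, congrArg Subtype.val hr⟩
  obtain ⟨r, hr⟩ := key u hu hk
  obtain ⟨r', hr'⟩ := key u' hu' hk'
  have hC : ∀ (a : ℂ) (w : MvPolynomial (Fin 3) ℂ),
      Ideal.Quotient.mk (jacobianIdeal g) (C a * w) = a • Ideal.Quotient.mk (jacobianIdeal g) w :=
    fun a w => by rw [← smul_eq_C_mul]; rfl
  by_cases h0 : r = 0
  · refine ⟨1, 0, Or.inl one_ne_zero, ?_⟩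
    rw [← Ideal.Quotient.eq_zero_iff_mem, map_add, hC, hC, ← hr, h0]
    simp
  · refine ⟨-r', r, Or.inr h0, ?_⟩
    rw [← Ideal.Quotient.eq_zero_iff_mem, map_add, hC, hC, ← hr, ← hr', smul_smul, smul_smul,
      neg_mul, mul_comm r' r, neg_smul, neg_add_cancel]

/-- The exponents of a nearly free curve of degree `m + 1` satisfy `d₁ + d₂ ≤ m + 1`. -/
theorem GeneratesSyzygies.degree_add_le_of_rank_le_one {g : MvPolynomial (Fin 3) ℂ}
    {ρ : Fin 3 → Fin 3 → MvPolynomial (Fin 3) ℂ} {m' d₁ d₂ : ℕ}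
    (hg : IsCoprimeTuple fun i => pderiv i g) (hg0 : (fun i => pderiv i g) ≠ 0)
    (hgm : IsHomogeneousTuple (fun i => pderiv i g) (m' + 2))
    (hρ : GeneratesSyzygies (fun i => pderiv i g) ρ)
    (hrank : ∀ k, Module.rank ℂ (jacobianModulePiece g k) ≤ 1) (hd : d₁ ≤ d₂)
    (h0 : IsHomogeneousTuple (ρ 0) d₁) (h1 : IsHomogeneousTuple (ρ 1) d₂)
    (h2 : IsHomogeneousTuple (ρ 2) d₂) : d₁ + d₂ ≤ m' + 3 := by
  obtain ⟨c, hc, hcop⟩ := exists_isMinorTuple hg hg0 hρ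
  -- The minors then have degrees `s + e + 2`, `s + 2`, `s + 2`, all at least two, so the connecting
  -- map is defined on every quadratic monomial.
  by_contra! hlt
  obtain ⟨s, hs⟩ := Nat.exists_eq_add_of_le hlt
  obtain ⟨e, rfl⟩ := Nat.exists_eq_add_of_le hd
  have hD : ∀ l, IsHomogeneousTuple (ρ l) (![d₁, d₁ + e, d₁ + e] l) := fun l => by
    fin_cases l
    exacts [h0, h1, h2]
  have hn0 : (c 0).IsHomogeneous (s + e + 2) := by
    refine hgm.isHomogeneous_of_smul hg0 ?_
    rw [← hc.cross_one_two]
    convert h1.cross h2 using 1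
    omega
  have hn1 : (c 1).IsHomogeneous (s + 2) := by
    refine hgm.isHomogeneous_of_smul hg0 ?_
    rw [← hc.cross_two_zero]
    convert h2.cross h0 using 1
    omega
  have hn2 : (c 2).IsHomogeneous (s + 2) := by
    refine hgm.isHomogeneous_of_smul hg0 ?_
    rw [← hc.cross_zero_one]
    convert h0.cross h1 using 1
    omega
  have hn : ∀ l, (c l).IsHomogeneous (![s + e, s, s] l + 2) := fun l => by
    fin_cases l
    exacts [hn0, hn1, hn2]
  have ht : ∀ l, ![s + e, s, s] l + ![d₁, d₁ + e, d₁ + e] l = s + e + d₁ := fun l => by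
    fin_cases l <;> simp <;> ring
  -- Two monomials independent modulo the squares have images of equal degree, hence dependent
  -- modulo the Jacobian ideal; this contradicts injectivity.
  obtain ⟨u, hu, hqu⟩ := exists_isConnectingImage hg0 hgm hρ hc hn hD ht
    (q := X 0 * X 1) ((isHomogeneous_X ℂ _).mul (isHomogeneous_X ℂ _))
  obtain ⟨u', hu', hqu'⟩ := exists_isConnectingImage hg0 hgm hρ hc hn hD ht
    (q := X 0 * X 2) ((isHomogeneous_X ℂ _).mul (isHomogeneous_X ℂ _))
  obtain ⟨a, a', hne, hmem⟩ := exists_smul_add_smul_mem (hrank _)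
    (mem_saturatedJacobianIdeal hqu.sq_mul_mem) (mem_saturatedJacobianIdeal hqu'.sq_mul_mem) hu hu'
  have hq := ((hqu.mul_left (C a)).add (hqu'.mul_left (C a'))).mem_of_mem hg0 hρ hc hcop hmem
  have hX : ∀ i j : Fin 3, (X i * X j : MvPolynomial (Fin 3) ℂ) =
      monomial (Finsupp.single i 1 + Finsupp.single j 1) 1 := fun i j => by
    simp [X, monomial_mul]
  have key : ∀ i j : Fin 3, i ≠ j →
      coeff (Finsupp.single i 1 + Finsupp.single j 1)
        (C a * (X 0 * X 1) + C a' * (X 0 * X 2) : MvPolynomial (Fin 3) ℂ) = 0 := fun i j hij => by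
    refine coeff_eq_zero_of_mem_span_X_sq hq fun v => ?_
    simp only [Finsupp.add_apply, Finsupp.single_apply]
    split_ifs <;> omega
  have k1 := key 0 1 (by decide)
  have k2 := key 0 2 (by decide)
  have hne12 : (Finsupp.single (0 : Fin 3) 1 + Finsupp.single 1 1 : Fin 3 →₀ ℕ) ≠
      Finsupp.single 0 1 + Finsupp.single 2 1 := fun h => by
    have := DFunLike.congr_fun h 1
    simp at this
  rw [hX, hX, coeff_add, coeff_C_mul, coeff_C_mul, coeff_monomial, coeff_monomial] at k1 k2
  simp [hne12, hne12.symm] at k1 k2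
  rcases hne with h | h
  · exact h k1
  · exact h k2

end NearlyFreeDegrees

/-! ### Relations of small degree involving the transversal derivative -/

section SmallRelations

variable {g b : Fin 3 → MvPolynomial (Fin 3) ℂ} {ρ : Fin 3 → Fin 3 → MvPolynomial (Fin 3) ℂ}
  {h b₀ : MvPolynomial (Fin 3) ℂ} {m e N : ℕ}

/-- A relation `b₀ h + b ⬝ g = 0` of degree `e` with `b₀ ≠ 0` rules out syzygies of `g` of
degree less than `m - e`. -/
theorem eq_zero_of_relation_of_lt (hg : IsCoprimeTuple g) (hg0 : g ≠ 0)
    (hgm : IsHomogeneousTuple g m)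
    (hN : ∀ i, ∃ (c : MvPolynomial (Fin 3) ℂ) (v : Fin 3 → MvPolynomial (Fin 3) ℂ),
      X i ^ N = c * h + v ⬝ᵥ g)
    (hb : b₀ * h + b ⬝ᵥ g = 0) (hb0 : b₀.IsHomogeneous e) (hne : b₀ ≠ 0)
    {s : Fin 3 → MvPolynomial (Fin 3) ℂ} {k : ℕ} (hs : s ⬝ᵥ g = 0) (hsk : IsHomogeneousTuple s k)
    (hk : e + k < m) : s = 0 := by
  obtain ⟨w, hw⟩ := exists_smul_eq_cross hg hg0 hN hb hs
  have h1 := (hsk.smul hb0).tupleComponent_eq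
  rw [hw, hgm.tupleComponent_cross_of_lt hk, ← hw] at h1
  exact (smul_eq_zero.1 h1.symm).resolve_left hne

/-- If three syzygies of `g` of degree `m - e` are independent over the constants, there is
no relation `b₀ h + b ⬝ g = 0` of degree `e > 0` with `b₀ ≠ 0`. -/
theorem false_of_relation_of_eq (hg : IsCoprimeTuple g) (hg0 : g ≠ 0)
    (hgm : IsHomogeneousTuple g m)
    (hN : ∀ i, ∃ (c : MvPolynomial (Fin 3) ℂ) (v : Fin 3 → MvPolynomial (Fin 3) ℂ),
      X i ^ N = c * h + v ⬝ᵥ g)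
    (hb : b₀ * h + b ⬝ᵥ g = 0) (hb0 : b₀.IsHomogeneous e) (hne : b₀ ≠ 0) (he : e ≠ 0)
    (hρ : ∀ i, ρ i ⬝ᵥ g = 0) {k : ℕ} (hρk : ∀ i, IsHomogeneousTuple (ρ i) k) (hk : e + k = m)
    (hind : ∀ μ : Fin 3 → ℂ,
      ∑ i, (C (μ i) : MvPolynomial (Fin 3) ℂ) • ρ i = 0 → μ = 0) : False := by
  -- Both sides have degree exactly `m`, so only the constant term of `w` contributes.
  have hw : ∀ i, ∃ w : Fin 3 → ℂ, b₀ • ρ i = crossProduct g fun j => C (w j) := fun i => by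
    obtain ⟨w, hw⟩ := exists_smul_eq_cross hg hg0 hN hb (hρ i)
    refine ⟨fun j => coeff 0 (w j), ?_⟩
    have h1 := ((hρk i).smul hb0).tupleComponent_eq
    rw [hw, hk, ← add_zero m, hgm.tupleComponent_cross, ← hw] at h1
    rw [← h1]
    congr 1
    ext1 j
    rw [tupleComponent, homogeneousComponent_zero]
  choose W hW using hw
  have hcomb : ∀ μ : Fin 3 → ℂ,
      b₀ • ∑ i, (C (μ i) : MvPolynomial (Fin 3) ℂ) • ρ i =
        crossProduct g fun j => C ((μ ᵥ* of W) j) := fun μ => by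
    rw [Finset.smul_sum]
    simp_rw [smul_comm b₀, hW, ← map_smul, ← map_sum]
    congr 1
    ext1 j
    simp [vecMul, dotProduct, Finset.sum_apply]
  by_cases hdet : (of W).det = 0
  · obtain ⟨μ, hμ0, hμ⟩ := exists_vecMul_eq_zero_iff.2 hdet
    refine hμ0 (hind μ ?_)
    have h1 := hcomb μ
    rw [hμ] at h1
    have hz : (fun j => C ((0 : Fin 3 → ℂ) j) : Fin 3 → MvPolynomial (Fin 3) ℂ) = 0 := by
      ext1 j
      simp
    rw [hz, map_zero] at h1
    exact (smul_eq_zero.1 h1).resolve_left hne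
  -- For invertible `W` every `g × v` with `v` constant is a combination of the `b₀ • ρ i`, so `b₀`
  -- divides all entries of `g`.
  · have hdvd : ∀ v : Fin 3 → ℂ, ∀ i, b₀ ∣ crossProduct g (fun j => C (v j)) i := fun v i => by
      have h1 := hcomb (v ᵥ* (of W)⁻¹)
      rw [vecMul_vecMul, nonsing_inv_mul _ (isUnit_iff_ne_zero.2 hdet), vecMul_one] at h1
      rw [← h1]
      exact dvd_mul_right _ _
    obtain ⟨p, hp, hpb⟩ := exists_prime_dvd_of_isHomogeneous hb0 hne he
    refine hg p hp fun i => hpb.trans ?_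
    fin_cases i
    · simpa [cross_apply] using hdvd ![0, 1, 0] 2
    · simpa [cross_apply] using hdvd ![0, 0, 1] 0
    · simpa [cross_apply] using hdvd ![1, 0, 0] 1

end SmallRelations

/-! ### No small relations for free and nearly free curves -/

section Curves

variable {g h b₀ : MvPolynomial (Fin 3) ℂ} {b : Fin 3 → MvPolynomial (Fin 3) ℂ} {d e N d₁ d₂ : ℕ}

/-- The gradient of a polynomial in three variables. -/
noncomputable abbrev gradient (g : MvPolynomial (Fin 3) ℂ) : Fin 3 → MvPolynomial (Fin 3) ℂ :=
  fun i => pderiv i g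

theorem IsFreeCurve.eq_zero_of_relation (hC : IsFreeCurve g d₁ d₂) (hd : d₁ ≤ d₂) (hd0 : d ≠ 0)
    (hg : g.IsHomogeneous d)
    (hN : ∀ i, ∃ (c : MvPolynomial (Fin 3) ℂ) (v : Fin 3 → MvPolynomial (Fin 3) ℂ),
      X i ^ N = c * h + v ⬝ᵥ gradient g)
    (hb : b₀ * h + b ⬝ᵥ gradient g = 0) (hb0 : b₀.IsHomogeneous e) (hbe : IsHomogeneousTuple b e)
    (he : e < d₁) : b₀ = 0 ∧ b = 0 := by
  obtain ⟨hsq, B, hB0, hB1⟩ := hC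
  have hcop : IsCoprimeTuple (gradient g) := isCoprimeTuple_pderiv hd0 hg hsq
  have hg0 : gradient g ≠ 0 := hcop.ne_zero ⟨X 0, X_prime⟩
  have hgm : IsHomogeneousTuple (gradient g) (d - 1) := fun i => hg.pderiv
  have hρ : GeneratesSyzygies (gradient g) ![B 0, B 1, 0] := by
    refine ⟨fun i => ?_, fun s hs => ?_⟩
    · fin_cases i
      exacts [(B 0).2, (B 1).2, zero_dotProduct _]
    · have := congrArg Subtype.val (B.sum_repr ⟨s, hs⟩)
      refine ⟨![B.repr ⟨s, hs⟩ 0, B.repr ⟨s, hs⟩ 1, 0], ?_⟩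
      rw [Fin.sum_univ_two] at this
      simpa [Fin.sum_univ_three] using this.symm
  have hdeg := hρ.degree_add_le hcop hg0 hgm rfl hB0 hB1
  by_cases hne : b₀ = 0
  · refine ⟨hne, ?_⟩
    rw [hne, zero_mul, zero_add] at hb
    -- The padding generator zero is homogeneous of every degree; `e + 1` is chosen to exceed `e`.
    refine hρ.eq_zero_of_isHomogeneousTuple (D := ![d₁, d₂, e + 1]) (e := e) (fun i => ?_)
      (fun i => ?_) hbe hb
    · fin_cases i
      exacts [hB0, hB1, fun _ => isHomogeneous_zero _ _ _]
    · fin_cases i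
      exacts [he, he.trans_le hd, e.lt_succ_self]
  -- Here `e + d₁ < d₁ + d₂ ≤ d - 1`.
  · exact absurd (Subtype.ext (eq_zero_of_relation_of_lt hcop hg0 hgm hN hb hb0 hne (B 0).2 hB0
      (by omega))) (B.ne_zero 0)

theorem IsNearlyFreeCurve.eq_zero_of_relation (hC : IsNearlyFreeCurve g)
    (hE : HasNearlyFreeExponents g d₁ d₂) (hd : d₁ ≤ d₂) (hd0 : 3 ≤ d)
    (hg : g.IsHomogeneous d)
    (hN : ∀ i, ∃ (c : MvPolynomial (Fin 3) ℂ) (v : Fin 3 → MvPolynomial (Fin 3) ℂ),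
      X i ^ N = c * h + v ⬝ᵥ gradient g)
    (hb : b₀ * h + b ⬝ᵥ gradient g = 0) (hb0 : b₀.IsHomogeneous e) (hbe : IsHomogeneousTuple b e)
    (he : e < d₁) : b₀ = 0 ∧ b = 0 := by
  obtain ⟨hsq, -, hrank⟩ := hC
  obtain ⟨ρ, hspan, hmin, h0, h1, h2⟩ := hE
  obtain ⟨d, rfl⟩ := Nat.exists_eq_add_of_le' hd0
  have hcop : IsCoprimeTuple (gradient g) := isCoprimeTuple_pderiv (by omega) hg hsq
  have hg0 : gradient g ≠ 0 := hcop.ne_zero ⟨X 0, X_prime⟩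
  have hgm : IsHomogeneousTuple (gradient g) (d + 2) := fun i => hg.pderiv
  have hρ : GeneratesSyzygies (gradient g) ρ := by
    refine ⟨fun i => ?_, fun s hs => ?_⟩
    · have : ρ i ∈ syzygyModule g := hspan ▸ Submodule.subset_span ⟨i, rfl⟩
      exact this
    · have : s ∈ syzygyModule g := hs
      rw [← hspan, Submodule.mem_span_range_iff_exists_fun] at this
      obtain ⟨a, ha⟩ := this
      exact ⟨a, ha.symm⟩
  have hdeg := hρ.degree_add_le_of_rank_le_one hcop hg0 hgm hrank hd h0 h1 h2
  by_cases hne : b₀ = 0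
  · refine ⟨hne, ?_⟩
    rw [hne, zero_mul, zero_add] at hb
    refine hρ.eq_zero_of_isHomogeneousTuple (D := ![d₁, d₂, d₂]) (e := e) (fun i => ?_)
      (fun i => ?_) hbe hb
    · fin_cases i
      exacts [h0, h1, h2]
    · fin_cases i
      exacts [he, he.trans_le hd, he.trans_le hd]
  exfalso
  rcases lt_or_ge (e + d₁) (d + 2) with hlt | hge
  · refine hmin 0 ?_
    rw [eq_zero_of_relation_of_lt hcop hg0 hgm hN hb hb0 hne (hρ.dotProduct_eq_zero 0) h0 hlt]
    exact zero_mem _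
  -- From `e < d₁ ≤ d₂` and `d₁ + d₂ ≤ d + 3` only `e + d₁ = d + 2` with equal exponents is left
  -- (`d` is now the degree of the curve minus three). Minimality makes the generators independent
  -- over the constants.
  · obtain rfl : d₁ = d₂ := by omega
    refine false_of_relation_of_eq hcop hg0 hgm hN hb hb0 hne (by omega) hρ.dotProduct_eq_zero
      (k := d₁) (fun i => ?_) (by omega) fun μ hμ => ?_
    · fin_cases i
      exacts [h0, h1, h2]
    · by_contra hμ0
      obtain ⟨j, hj⟩ := exists_ne_zero_of_ne_zero hμ0
      refine hmin j ?_
      rw [← Finset.add_sum_erase _ _ (Finset.mem_univ j)] at hμ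
      have hj' : ρ j = (C (-(μ j)⁻¹) : MvPolynomial (Fin 3) ℂ) •
          ∑ i ∈ Finset.univ.erase j, (C (μ i) : MvPolynomial (Fin 3) ℂ) • ρ i := by
        rw [eq_neg_of_add_eq_zero_right hμ, smul_neg, smul_smul, ← C_mul, neg_mul,
          inv_mul_cancel₀ hj]
        simp
      rw [hj']
      exact Submodule.smul_mem _ _ (Submodule.sum_mem _ fun i hi => Submodule.smul_mem _ _
        (Submodule.subset_span ⟨i, Finset.ne_of_mem_erase hi, rfl⟩))

end Curves

/-! ### Chain rule, projective zeros and the Nullstellensatz -/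

section General

theorem pderiv_aeval {σ τ : Type*} [Fintype σ] {K : Type*} [CommRing K]
    (φ : σ → MvPolynomial τ K) (f : MvPolynomial σ K) (j : τ) :
    pderiv j (aeval φ f) = ∑ i, aeval φ (pderiv i f) * pderiv j (φ i) := by
  classical
  induction f using MvPolynomial.induction_on with
  | C a => simp
  | add p q hp hq => simp only [map_add, hp, hq, add_mul, Finset.sum_add_distrib]
  | mul_X p i hp =>
    simp only [map_mul, aeval_X, pderiv_mul, hp, map_add, add_mul, Finset.sum_add_distrib,
      Finset.sum_mul, pderiv_X]
    congr 1
    · exact Finset.sum_congr rfl fun _ _ => by ring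
    · rw [Finset.sum_eq_single i]
      · simp
      · intro b _ hb
        simp [hb.symm]
      · simp

theorem eval_smul_of_isHomogeneous {σ K : Type*} [Fintype σ] [CommSemiring K]
    {f : MvPolynomial σ K} {n : ℕ} (hf : f.IsHomogeneous n) (c : K) (x : σ → K) :
    eval (c • x) f = c ^ n * eval x f := by
  rw [eval_eq', eval_eq', Finset.mul_sum]
  refine Finset.sum_congr rfl fun m hm => ?_
  rw [(hf.degree_eq_sum_deg_support hm).trans (Finsupp.degree_eq_sum m)]
  simp only [Pi.smul_apply, smul_eq_mul, mul_pow, Finset.prod_mul_distrib,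
    Finset.prod_pow_eq_pow_sum]
  ring

theorem exists_eq_sum_C_mul_X {σ K : Type*} [Fintype σ] [CommSemiring K] {l : MvPolynomial σ K}
    (hl : l.IsHomogeneous 1) : ∃ m : σ → K, l = ∑ i, C (m i) * X i := by
  have h := (mem_homogeneousSubmodule 1 l).2 hl
  rw [homogeneousSubmodule_one_eq_span_X, Submodule.mem_span_range_iff_exists_fun] at h
  obtain ⟨m, hm⟩ := h
  exact ⟨m, by simp_rw [← hm, smul_eq_C_mul]⟩

theorem mem_projectiveZeros_mk {n d : ℕ} {f : MvPolynomial (Fin n) ℂ} (hf : f.IsHomogeneous d)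
    {x : Fin n → ℂ} (hx : x ≠ 0) (h : eval x f = 0) :
    Projectivization.mk ℂ x hx ∈ projectiveZeros f := by
  obtain ⟨a, ha⟩ := Projectivization.exists_smul_eq_mk_rep ℂ x hx
  change eval (Projectivization.mk ℂ x hx).rep f = 0
  rw [← ha, Units.smul_def, eval_smul_of_isHomogeneous hf, h, mul_zero]

/-- By the Nullstellensatz, an ideal vanishing at most at the origin contains powers of the
variables. -/
theorem exists_X_pow_mem {n : ℕ} {I : Ideal (MvPolynomial (Fin n) ℂ)}
    (h : ∀ x : Fin n → ℂ, (∀ p ∈ I, eval x p = 0) → x = 0) : ∃ N, ∀ i, X i ^ N ∈ I := by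
  have hrad : ∀ i, X i ∈ I.radical := fun i => by
    rw [← vanishingIdeal_zeroLocus_eq_radical (K := ℂ)]
    intro x hx
    rw [h x fun p hp => hx p hp]
    simp
  choose N hN using hrad
  exact ⟨∑ i, N i, fun i => I.pow_mem_of_pow_mem (hN i)
    (Finset.single_le_sum (fun _ _ => Nat.zero_le _) (Finset.mem_univ i))⟩

end General

/-! ### Restriction to the plane -/

section PlaneSection

variable {l f : MvPolynomial (Fin 4) ℂ} {A : Matrix (Fin 4) (Fin 3) ℂ}

/-- The restriction of polynomials to the plane parametrized by `A`. -/
noncomputable abbrev restriction (A : Matrix (Fin 4) (Fin 3) ℂ) :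
    MvPolynomial (Fin 4) ℂ →ₐ[ℂ] MvPolynomial (Fin 3) ℂ :=
  aeval fun i => ∑ j, C (A i j) * X j

theorem isHomogeneous_restriction {p : MvPolynomial (Fin 4) ℂ} {n : ℕ} (hp : p.IsHomogeneous n) :
    (restriction A p).IsHomogeneous n := by
  have := hp.aeval (fun i => ∑ j, C (A i j) * X j : Fin 4 → MvPolynomial (Fin 3) ℂ)
    (n := 1) fun i => IsHomogeneous.sum _ _ _ fun j _ => isHomogeneous_C_mul_X _ _
  rwa [one_mul] at this

theorem eval_restriction (p : MvPolynomial (Fin 4) ℂ) (y : Fin 3 → ℂ) :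
    eval y (restriction A p) = eval (A.mulVec y) p := by
  induction p using MvPolynomial.induction_on with
  | C a => simp
  | add p q hp hq => simp only [map_add, hp, hq]
  | mul_X p i hp =>
    simp only [map_mul, hp, aeval_X, eval_X, map_sum, eval_C, mulVec, dotProduct]

theorem pderiv_restriction (p : MvPolynomial (Fin 4) ℂ) (j : Fin 3) :
    pderiv j (restriction A p) = ∑ i, C (A i j) * restriction A (pderiv i p) := by
  classical
  rw [restriction, pderiv_aeval]
  refine Finset.sum_congr rfl fun i _ => ?_
  rw [map_sum, Finset.sum_eq_single j]
  · simp [mul_comm]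
  · intro b _ hb
    simp [pderiv_X_of_ne hb]
  · simp

/-- A plane `l = 0` with coordinate system `A` and a complementary vector `v` decompose the
ambient space: `x = l(x) v + A (B x)`. -/
theorem IsCoordinateSystem.exists_decomposition (hA : IsCoordinateSystem l A)
    (hl : l.IsHomogeneous 1) (hl0 : l ≠ 0) :
    ∃ (m v : Fin 4 → ℂ) (B : Fin 3 → Fin 4 → ℂ), l = ∑ i, C (m i) * X i ∧
      ∀ i i', (if i = i' then 1 else 0) = v i * m i' + ∑ j, A i j * B j i' := by
  obtain ⟨m, rfl⟩ := exists_eq_sum_C_mul_X hl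
  have heval : ∀ x, eval x (∑ i, C (m i) * X i) = ∑ i, m i * x i := fun x => by simp
  have hm : ∃ i, m i ≠ 0 := by
    by_contra! h
    exact hl0 (by simp [h])
  obtain ⟨i₀, hi₀⟩ := hm
  -- The vector `v = e_{i₀} / m_{i₀}` has `l(v) = 1`, so `e_{i'} - m_{i'} v` lies in the plane.
  have hB : ∀ i', ∃ y, A.mulVec y =
      fun i => (if i = i' then 1 else 0) - (Pi.single i₀ (m i₀)⁻¹ : Fin 4 → ℂ) i * m i' :=
      fun i' => by
    have : (fun i => (if i = i' then 1 else 0) -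
        (Pi.single i₀ (m i₀)⁻¹ : Fin 4 → ℂ) i * m i') ∈ Set.range A.mulVec := by
      rw [hA.2]
      change eval _ _ = 0
      rw [heval]
      simp only [mul_sub, Finset.sum_sub_distrib, mul_ite, mul_one, mul_zero,
        Finset.sum_ite_eq', Finset.mem_univ, if_true, ← mul_assoc, ← Finset.sum_mul]
      simp [Pi.single_apply, hi₀]
    exact this
  choose B hB using hB
  refine ⟨m, Pi.single i₀ (m i₀)⁻¹, fun j i' => B i' j, rfl, fun i i' => ?_⟩
  have := congrFun (hB i') i
  simp only [mulVec, dotProduct] at this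
  rw [this]
  ring

/-- A polynomial vanishing on the plane `l = 0` is divisible by `l`. -/
theorem IsCoordinateSystem.dvd_of_restriction_eq_zero (hA : IsCoordinateSystem l A)
    (hl : l.IsHomogeneous 1) (hl0 : l ≠ 0) {p : MvPolynomial (Fin 4) ℂ}
    (hp : restriction A p = 0) : l ∣ p := by
  obtain ⟨m, v, B, hlm, hdec⟩ := hA.exists_decomposition hl hl0
  let ψ : MvPolynomial (Fin 3) ℂ →ₐ[ℂ] MvPolynomial (Fin 4) ℂ :=
    aeval fun j => ∑ i', C (B j i') * X i'
  -- Composing restriction with `ψ` is the identity modulo `l`, because `x - A (B x) = l(x) v`.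
  have h : (Ideal.Quotient.mkₐ ℂ (Ideal.span {l})).comp (ψ.comp (restriction A)) =
      Ideal.Quotient.mkₐ ℂ (Ideal.span {l}) := by
    refine MvPolynomial.algHom_ext fun i => ?_
    simp only [AlgHom.comp_apply, Ideal.Quotient.mkₐ_eq_mk]
    rw [Ideal.Quotient.eq, Ideal.mem_span_singleton]
    refine ⟨-C (v i), ?_⟩
    have hX : (X i : MvPolynomial (Fin 4) ℂ) =
        ∑ i', C (if i = i' then 1 else 0) * X i' := by
      simp [apply_ite C]
    have hψ : ψ (restriction A (X i)) = ∑ i', C (∑ j, A i j * B j i') * X i' := by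
      simp only [restriction, aeval_X, map_sum, map_mul, ψ, algHom_C, Finset.mul_sum,
        Finset.sum_mul, MvPolynomial.algebraMap_eq]
      rw [Finset.sum_comm]
      simp only [mul_assoc]
    rw [hψ, hX, ← Finset.sum_sub_distrib, hlm, Finset.sum_mul]
    refine Finset.sum_congr rfl fun i' _ => ?_
    rw [hdec, map_add, map_mul]
    ring
  have h1 := DFunLike.congr_fun h p
  rw [AlgHom.comp_apply, AlgHom.comp_apply, hp, map_zero, map_zero] at h1
  exact Ideal.mem_span_singleton.1 (Ideal.Quotient.eq_zero_iff_mem.1 h1.symm)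

/-- If the plane `l = 0` contains no singular point of `f = 0`, the restrictions of the partial
derivatives of `f` generate an ideal containing powers of the variables. -/
theorem IsCoordinateSystem.exists_X_pow_mem (hA : IsCoordinateSystem l A) (hl : l.IsHomogeneous 1)
    {d : ℕ} (hd : d ≠ 0) (hf : f.IsHomogeneous d)
    (hH : singularLocus f ∩ projectiveZeros l = ∅) :
    ∃ N, ∀ j, X j ^ N ∈ Ideal.span (Set.range fun i => restriction A (pderiv i f)) := by
  refine JacobianLefschetz.exists_X_pow_mem fun y hy => ?_
  by_contra hy0
  have hx : A.mulVec y ≠ 0 := fun h => hy0 (hA.1 (by rw [h, mulVec_zero]))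
  have hpd : ∀ i, eval (A.mulVec y) (pderiv i f) = 0 := fun i => by
    rw [← eval_restriction]
    exact hy _ (Ideal.subset_span ⟨i, rfl⟩)
  have hl0 : eval (A.mulVec y) l = 0 := by
    have : A.mulVec y ∈ Set.range A.mulVec := ⟨y, rfl⟩
    rw [hA.2] at this
    exact this
  have hf0 : eval (A.mulVec y) f = 0 := by
    have h := congrArg (eval (A.mulVec y)) hf.sum_X_mul_pderiv
    simp only [map_sum, map_mul, hpd, mul_zero, Finset.sum_const_zero, map_nsmul] at h
    exact (smul_eq_zero.1 h.symm).resolve_left hd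
  have hmem : Projectivization.mk ℂ _ hx ∈ singularLocus f ∩ projectiveZeros l :=
    ⟨⟨mem_projectiveZeros_mk hf hx hf0, fun i => mem_projectiveZeros_mk hf.pderiv hx (hpd i)⟩,
      mem_projectiveZeros_mk hl hx hl0⟩
  rw [hH] at hmem
  exact hmem

/-- If the restrictions of the partial derivatives of `f` have no nontrivial relation of degree
`e`, then multiplication by `l` on the Milnor algebra is injective in degree `d + e - 2`. -/
theorem mem_jacobianIdeal_of_mul_mem (hl0 : l ≠ 0) {d k : ℕ} (hf : f.IsHomogeneous d)
    (hl : l.IsHomogeneous 1) (hA : IsCoordinateSystem l A)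
    (hrel : ∀ e, e + (d - 1) = k + 1 → ∀ a : Fin 4 → MvPolynomial (Fin 3) ℂ,
      (∀ i, (a i).IsHomogeneous e) → ∑ i, a i * restriction A (pderiv i f) = 0 → a = 0)
    {q : MvPolynomial (Fin 4) ℂ} (hq : q.IsHomogeneous k) (hlq : l * q ∈ jacobianIdeal f) :
    q ∈ jacobianIdeal f := by
  obtain ⟨a, ha⟩ := Ideal.mem_span_range_iff_exists_fun.1 hlq
  have hlqk : (l * q).IsHomogeneous (k + 1) := add_comm 1 k ▸ hl.mul hq
  have hcomp := homogeneousComponent_eq_self hlqk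
  rw [← ha, map_sum] at hcomp
  -- Below degree `d - 1` the Jacobian ideal has no nonzero forms.
  rcases lt_or_ge (k + 1) (d - 1) with hlt | hge
  · rw [ha, Finset.sum_eq_zero fun i _ => by
      rw [mul_comm, homogeneousComponent_mul_of_lt (hf.pderiv (i := i)) hlt]] at hcomp
    rw [(mul_eq_zero.1 hcomp.symm).resolve_left hl0]
    exact zero_mem _
  · obtain ⟨e, he⟩ := Nat.exists_eq_add_of_le hge
    have hsum : ∑ i, homogeneousComponent e (a i) * pderiv i f = l * q := by
      rw [← ha, ← hcomp, he]
      refine Finset.sum_congr rfl fun i _ => ?_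
      rw [mul_comm (a i), homogeneousComponent_add_mul hf.pderiv, mul_comm]
    have hres : restriction A l = 0 := by
      refine MvPolynomial.funext fun y => ?_
      have : A.mulVec y ∈ Set.range A.mulVec := ⟨y, rfl⟩
      rw [hA.2] at this
      rw [eval_restriction, map_zero]
      exact this
    have hzero := hrel e (by omega) (fun i => restriction A (homogeneousComponent e (a i)))
      (fun i => isHomogeneous_restriction (homogeneousComponent_isHomogeneous e (a i))) (by
        have := congrArg (restriction A) hsum
        rwa [map_mul, hres, zero_mul, map_sum, Finset.sum_congr rfl fun i _ => map_mul _ _ _]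
          at this)
    choose c hc using fun i => hA.dvd_of_restriction_eq_zero hl hl0 (congrFun hzero i)
    have hqc : q = ∑ i, c i * pderiv i f := by
      refine mul_left_cancel₀ hl0 ?_
      rw [← hsum, Finset.mul_sum]
      exact Finset.sum_congr rfl fun i _ => by rw [hc i, mul_assoc]
    rw [hqc]
    exact Ideal.sum_mem _ fun i _ => Ideal.mul_mem_left _ _ (Ideal.subset_span ⟨i, rfl⟩)

theorem eq_add_sum_of_decomposition {m v : Fin 4 → ℂ} {B : Fin 3 → Fin 4 → ℂ}
    (hdec : ∀ i i', (if i = i' then 1 else 0) = v i * m i' + ∑ j, A i j * B j i')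
    (z : Fin 4 → MvPolynomial (Fin 3) ℂ) (i : Fin 4) :
    z i = C (v i) * (∑ i', C (m i') * z i') + ∑ j, C (A i j) * ∑ i', C (B j i') * z i' := by
  have h1 : z i = ∑ i', C (if i = i' then 1 else 0) * z i' := by simp [apply_ite C]
  simp only [Finset.mul_sum]
  rw [h1, Finset.sum_comm, ← Finset.sum_add_distrib]
  refine Finset.sum_congr rfl fun i' _ => ?_
  rw [hdec, map_add, map_mul, map_sum, add_mul, Finset.sum_mul]
  simp only [map_mul, mul_assoc]

/-- A change of frame to `v` and the columns of `A`: with `F` the restricted partials of `f`, the `G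
j` are the partials of the plane section and `∑ v_i F_i` is the derivative transversal to the plane.
-/
theorem sum_mul_eq_of_decomposition {m v : Fin 4 → ℂ} {B : Fin 3 → Fin 4 → ℂ}
    (hdec : ∀ i i', (if i = i' then 1 else 0) = v i * m i' + ∑ j, A i j * B j i')
    {F : Fin 4 → MvPolynomial (Fin 3) ℂ} {G : Fin 3 → MvPolynomial (Fin 3) ℂ}
    (hG : ∀ j, G j = ∑ i, C (A i j) * F i) (z : Fin 4 → MvPolynomial (Fin 3) ℂ) :
    ∑ i, z i * F i = (∑ i', C (m i') * z i') * (∑ i, C (v i) * F i) +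
      (fun j => ∑ i', C (B j i') * z i') ⬝ᵥ G := by
  have hz := eq_add_sum_of_decomposition hdec z
  generalize (∑ i', C (m i') * z i') = b₀ at hz ⊢
  generalize hb : (fun j => ∑ i', C (B j i') * z i') = b
  have hb' : ∀ j, ∑ i', C (B j i') * z i' = b j := congrFun hb
  simp only [hb'] at hz
  rw [dotProduct, Finset.sum_congr rfl fun i _ => by rw [hz i, add_mul],
    Finset.sum_add_distrib, Finset.mul_sum]
  congr 1
  · exact Finset.sum_congr rfl fun i _ => by ring
  · simp only [hG, Finset.sum_mul, Finset.mul_sum]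
    rw [Finset.sum_comm]
    exact Finset.sum_congr rfl fun j _ => Finset.sum_congr rfl fun i _ => by ring

end PlaneSection

end JacobianLefschetz

/-! ### The injectivity theorem -/

open JacobianLefschetz

theorem proposition3p4
    (d : ℕ) (hd : 3 ≤ d)
    (f : MvPolynomial (Fin 4) ℂ) (hf : f.IsHomogeneous d)
    (hsing : JacobianLefschetz.HasIsolatedSingularities f)
    (l : MvPolynomial (Fin 4) ℂ) (hl : l.IsHomogeneous 1) (hl0 : l ≠ 0)
    (hH : JacobianLefschetz.singularLocus f ∩ JacobianLefschetz.projectiveZeros l = ∅)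
    (A : Matrix (Fin 4) (Fin 3) ℂ) (hA : JacobianLefschetz.IsCoordinateSystem l A)
    (d₁ d₂ : ℕ) (hd₁₂ : d₁ ≤ d₂)
    (hC : JacobianLefschetz.IsFreeCurve (JacobianLefschetz.restrictToPlane f A) d₁ d₂ ∨
      (JacobianLefschetz.IsNearlyFreeCurve (JacobianLefschetz.restrictToPlane f A) ∧
        JacobianLefschetz.HasNearlyFreeExponents (JacobianLefschetz.restrictToPlane f A) d₁ d₂))
    (k : ℕ) (hk : (k : ℤ) ≤ (d : ℤ) + d₁ - 3) :
    Function.Injective (JacobianLefschetz.mulByLinearForm f l hl k) := by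
  rw [injective_iff_map_eq_zero]
  rintro ⟨_, q, hq, rfl⟩ hx
  have hlq : l * q ∈ jacobianIdeal f := by
    rw [← Ideal.Quotient.eq_zero_iff_mem, map_mul]
    exact congrArg Subtype.val hx
  refine Subtype.ext (Ideal.Quotient.eq_zero_iff_mem.2
    (mem_jacobianIdeal_of_mul_mem hl0 hf hl hA (fun e he a ha hrel => ?_) hq hlq))
  obtain ⟨m, v, B, -, hdec⟩ := hA.exists_decomposition hl hl0
  have hg : (restrictToPlane f A).IsHomogeneous d := isHomogeneous_restriction hf
  have hgrad : ∀ j, gradient (restrictToPlane f A) j =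
      ∑ i, C (A i j) * restriction A (pderiv i f) := pderiv_restriction f
  have hsplit := sum_mul_eq_of_decomposition hdec hgrad
  obtain ⟨N, hN⟩ := hA.exists_X_pow_mem hl (by omega) hf hH
  have hN' : ∀ j, ∃ (c : MvPolynomial (Fin 3) ℂ) (w : Fin 3 → MvPolynomial (Fin 3) ℂ),
      X j ^ N = c * (∑ i, C (v i) * restriction A (pderiv i f)) +
        w ⬝ᵥ gradient (restrictToPlane f A) := fun j => by
    obtain ⟨z, hz⟩ := Ideal.mem_span_range_iff_exists_fun.1 (hN j)
    exact ⟨_, _, hz.symm.trans (hsplit z)⟩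
  have hb := hrel
  rw [hsplit a] at hb
  have hhom : ∀ c : Fin 4 → ℂ, (∑ i, C (c i) * a i).IsHomogeneous e := fun c =>
    IsHomogeneous.sum _ _ _ fun i _ => (ha i).C_mul _
  -- The degree is `e = k + 2 - d`, so the bound on `k` says exactly `e < d₁`.
  have hzero : (∑ i', C (m i') * a i') = 0 ∧ (fun j => ∑ i', C (B j i') * a i') = 0 := by
    rcases hC with hfree | ⟨hnear, hE⟩
    · exact hfree.eq_zero_of_relation hd₁₂ (by omega) hg hN' hb (hhom m) (fun j => hhom (B j))
        (by omega)
    · exact hnear.eq_zero_of_relation hE hd₁₂ hd hg hN' hb (hhom m) (fun j => hhom (B j))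
        (by omega)
  funext i
  have hB : ∀ j, ∑ i', C (B j i') * a i' = 0 := congrFun hzero.2
  rw [eq_add_sum_of_decomposition hdec a i, hzero.1]
  simp [hB]
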